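/- Let $\ell\ge 1$ be a constant, and let $\mathcal R$ be a Veto-like scoring rule: there are fixed rational numbers $a>a_1\ge a_2\ge\dots\ge a_\ell$ such that, for every $t>\ell$, the scoring vector of $\mathcal R$ for elections with $t$ candidates is $(a,\dots,a,a_1,\dots,a_\ell)$, with $t-\ell$ entries $a$; for each of the finitely many $t\le\ell$, where this form leaves no room for an entry $a$, any fixed rational vector may be used. (Each voter gives a candidate that she ranks at position $i$ the $i$-th entry of the vector, and the winners are the candidates with the highest total score.) An instance of Necessary President for $\mathcal R$ consists of a finite set $C$ of candidates, a finite set $V$ of voters, each with a strict linear order over $C$, a partition $\mathcal P$ of $C$ into nonempty parties, and a candidate $p\in C$. The question is whether, for every set $C'\subseteq C$ that contains $p$ and contains exactly one candidate of each party, $p$ is among the winners under $\mathcal R$ of the election in which every voter restricts her order to $C'$. Then Necessary President for $\mathcal R$ is fixed-parameter tractable when parameterized by the number $\tau$ of voter types, i.e., of distinct preference orders occurring among the voters: there are an algorithm, a computable function $f$ and a constant $d$ such that the algorithm decides every instance $I$ in at most $f(\tau)\cdot|I|^{d}$ steps, where $|I|$ is the length of the encoding of $I$. -/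

import Mathlib

/-! ### Elections, positional scoring rules, reduced elections -/

/-- An election with candidates `C` and voters `V`: every voter `v` has a strict linear order
on the candidates; `E.pref v c d` says that `v` prefers `c` to `d`. -/
@[ext]
structure Election (C V : Type) where
  pref : V → C → C → Prop
  strict : ∀ v, IsStrictTotalOrder C (pref v)

namespace Election

variable {C V : Type}

/-- The position (counted from `0`) of candidate `c` in the preference list of `v`, that is,
the number of candidates that `v` prefers to `c`. -/
noncomputable def position (E : Election C V) (v : V) (c : C) : ℕ :=
  {d | E.pref v d c}.ncard

/-- The number of voter types: voters with the same preferences have the same type. -/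
noncomputable def numTypes (E : Election C V) : ℕ := (Set.range E.pref).ncard

/-- The reduced election over the set `S` of nominees: all voters restrict their preferences
to `S`. -/
def restrict (E : Election C V) (S : Finset C) : Election S V where
  pref v c d := E.pref v c d
  strict v :=
    { trichotomous := fun c d h1 h2 => Subtype.ext ((E.strict v).trichotomous c d h1 h2)
      irrefl := fun c => (E.strict v).irrefl c
      trans := fun c d e => (E.strict v).trans c d e }

end Election

/-- The scoring vectors of a positional scoring rule: in an election with `t` candidates, a
candidate at position `i` of the preference list of a voter (counted from `0`, so `i < t`)
obtains `w t i` points from this voter. The values `w t i` with `t ≤ i` are never used. -/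
abbrev ScoringVectors := ℕ → ℕ → ℚ

/-- The total number of points that candidate `c` obtains. -/
noncomputable def Election.score {C V : Type} [Fintype C] [Fintype V] (w : ScoringVectors)
    (E : Election C V) (c : C) : ℚ :=
  ∑ v : V, w (Fintype.card C) (E.position v c)

/-- The winners are the candidates with the highest score. -/
def Election.winners {C V : Type} [Fintype C] [Fintype V] (w : ScoringVectors)
    (E : Election C V) : Set C :=
  {c | ∀ d, E.score w d ≤ E.score w c}

/-- `w` is the Veto-like scoring rule given by `(a, …, a, b 0, b 1, …, b (ℓ - 1))`: this is the
scoring vector for every number `t > ℓ` of candidates. (Nothing is said about the vectors for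
the finitely many `t ≤ ℓ`, which do not have room for `a` and all of `b`.) -/
def IsVetoLike (w : ScoringVectors) (ℓ : ℕ) (a : ℚ) (b : Fin ℓ → ℚ) : Prop :=
  ∀ t, ℓ < t → (∀ i, i < t - ℓ → w t i = a) ∧ ∀ j : Fin ℓ, w t (t - ℓ + j) = b j

/-- If `party : C → Fin t` tells the party of each candidate, then `S` is a possible set of
nominees when it contains exactly one candidate of every party. -/
def IsNomination {C : Type} {t : ℕ} (party : C → Fin t) (S : Finset C) : Prop :=
  ∀ j, ∃! c, c ∈ S ∧ party c = j

/-- `p` is a winner of every reduced election in which `p` is a nominee. -/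
def IsNecessaryPresident {C V : Type} [Fintype V] {t : ℕ} (w : ScoringVectors)
    (E : Election C V) (party : C → Fin t) (p : C) : Prop :=
  ∀ S : Finset C, IsNomination party S → ∀ hp : p ∈ S, ⟨p, hp⟩ ∈ (E.restrict S).winners w

/-! ### Instances and their encoding -/

/-- An instance: an election with candidates `0, …, m - 1` and voters `0, …, n - 1`, a partition
of the candidates into `t` (nonempty) parties, and a distinguished candidate `p`. -/
structure NPInstance where
  m : ℕ
  n : ℕ
  t : ℕ
  election : Election (Fin m) (Fin n)
  party : Fin m → Fin t
  party_surjective : Function.Surjective party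
  p : Fin m

/-- An instance is written down as the sequence of numbers consisting of `m`, `n`, `t`, `p`,
the party of each candidate, and, voter by voter, the position of each candidate in the
preference list of that voter. -/
noncomputable def NPInstance.encode (I : NPInstance) : List ℕ :=
  [I.m, I.n, I.t, (I.p : ℕ)] ++ List.ofFn (fun c => (I.party c : ℕ)) ++
    (List.ofFn fun v => List.ofFn fun c => I.election.position v c).flatten

theorem Election.pref_iff_position_lt {C V : Type} [Finite C] (E : Election C V) (v : V)
    (c d : C) : E.pref v c d ↔ E.position v c < E.position v d := by
  have key : ∀ x y, E.pref v x y → E.position v x < E.position v y := by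
    intro x y h
    refine Set.ncard_lt_ncard ?_ (Set.toFinite _)
    refine ⟨fun z hz => (E.strict v).trans z x y hz h, fun hsub => ?_⟩
    exact (E.strict v).irrefl x (hsub h)
  refine ⟨key c d, fun h => ?_⟩
  by_contra hcd
  by_cases hdc : E.pref v d c
  · exact absurd (key d c hdc) (by omega)
  · have := (E.strict v).trichotomous c d hcd hdc
    subst this
    exact lt_irrefl _ h

theorem NPInstance.encode_injective : Function.Injective NPInstance.encode := by
  rintro ⟨m, n, t, E, P, hP, p⟩ ⟨m', n', t', E', P', hP', p'⟩ h
  simp only [encode, List.cons_append, List.nil_append, List.cons.injEq] at h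
  obtain ⟨rfl, rfl, rfl, hp, h⟩ := h
  obtain ⟨h1, h2⟩ := List.append_inj h (by simp)
  have hPP : P = P' := by
    funext c
    exact Fin.ext (congrFun (List.ofFn_injective h1) c)
  have hpos : ∀ v c, E.position v c = E'.position v c := by
    intro v c
    have h3 := List.eq_iff_flatten_eq.2 ⟨h2, by simp [Function.comp_def]⟩
    exact congrFun (List.ofFn_injective (congrFun (List.ofFn_injective h3) v)) c
  have hE : E = E' := by
    ext v c d
    rw [E.pref_iff_position_lt, E'.pref_iff_position_lt, hpos, hpos]
  have hpp : p = p' := Fin.ext hp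
  subst hPP hE hpp
  rfl

/-! ### A random access machine language with running times -/

namespace RAM

/-- Expressions of a random access machine. Scalar variables and arrays are named by numbers;
they hold natural numbers. There is no multiplication, so that numbers cannot become longer
than (a constant plus) the longest input number plus the running time. -/
inductive Expr where
  | const (n : ℕ)
  | var (x : ℕ)
  | read (arr : ℕ) (i : Expr)
  | add (e₁ e₂ : Expr)
  | sub (e₁ e₂ : Expr)
  | lt (e₁ e₂ : Expr)

/-- Programs: assignments to variables and to cells of arrays, conditionals and loops. Any
program uses only finitely many variables and arrays. -/
inductive Program where
  | nop
  | assign (x : ℕ) (e : Expr)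
  | write (arr : ℕ) (i e : Expr)
  | seq (c₁ c₂ : Program)
  | ite (e : Expr) (c₁ c₂ : Program)
  | loop (e : Expr) (c : Program)

/-- The contents of the variables and of the arrays. -/
structure State where
  var : ℕ → ℕ
  arr : ℕ → ℕ → ℕ

/-- The value of an expression (`sub` is truncated subtraction; `lt` yields `1` or `0`). -/
def Expr.eval (s : State) : Expr → ℕ
  | const n => n
  | var x => s.var x
  | read a i => s.arr a (i.eval s)
  | add e₁ e₂ => e₁.eval s + e₂.eval s
  | sub e₁ e₂ => e₁.eval s - e₂.eval s
  | lt e₁ e₂ => if e₁.eval s < e₂.eval s then 1 else 0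

/-- The number of steps needed to evaluate an expression: one for each operation. -/
def Expr.cost : Expr → ℕ
  | const _ => 1
  | var _ => 1
  | read _ i => i.cost + 1
  | add e₁ e₂ => e₁.cost + e₂.cost + 1
  | sub e₁ e₂ => e₁.cost + e₂.cost + 1
  | lt e₁ e₂ => e₁.cost + e₂.cost + 1

/-- `Exec c s T s'`: program `c`, started in state `s`, halts after exactly `T` steps in
state `s'`. In tests, nonzero numbers count as true. -/
inductive Exec : Program → State → ℕ → State → Prop
  | nop (s : State) : Exec .nop s 1 s
  | assign (x : ℕ) (e : Expr) (s : State) :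
      Exec (.assign x e) s (e.cost + 1) { s with var := Function.update s.var x (e.eval s) }
  | write (a : ℕ) (i e : Expr) (s : State) :
      Exec (.write a i e) s (i.cost + e.cost + 1)
        { s with arr := Function.update s.arr a
                  (Function.update (s.arr a) (i.eval s) (e.eval s)) }
  | seq {c₁ c₂ : Program} {s s₁ s₂ : State} {T₁ T₂ : ℕ} :
      Exec c₁ s T₁ s₁ → Exec c₂ s₁ T₂ s₂ → Exec (.seq c₁ c₂) s (T₁ + T₂) s₂
  | ite_true {e : Expr} {c₁ c₂ : Program} {s s' : State} {T : ℕ} :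
      e.eval s ≠ 0 → Exec c₁ s T s' → Exec (.ite e c₁ c₂) s (e.cost + 1 + T) s'
  | ite_false {e : Expr} {c₁ c₂ : Program} {s s' : State} {T : ℕ} :
      e.eval s = 0 → Exec c₂ s T s' → Exec (.ite e c₁ c₂) s (e.cost + 1 + T) s'
  | loop_true {e : Expr} {c : Program} {s s₁ s₂ : State} {T₁ T₂ : ℕ} :
      e.eval s ≠ 0 → Exec c s T₁ s₁ → Exec (.loop e c) s₁ T₂ s₂ →
        Exec (.loop e c) s (e.cost + 1 + T₁ + T₂) s₂
  | loop_false {e : Expr} {c : Program} {s : State} :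
      e.eval s = 0 → Exec (.loop e c) s (e.cost + 1) s

/-- The initial state on input `u`: array `0` holds the input, variable `0` holds the number of
its entries, and everything else is `0`. -/
def initState (u : List ℕ) : State where
  var x := if x = 0 then u.length else 0
  arr a i := if a = 0 then u.getD i 0 else 0

/-- The length of an input: the number of binary digits of all its entries, with one separator
for each entry. -/
def inputLength (u : List ℕ) : ℕ := (u.map fun x => Nat.size x + 1).sum

/-- Programs are deterministic: the number of steps and the final state are determined. -/
theorem Exec.deterministic {c : Program} {s s₁ : State} {T₁ : ℕ} (h₁ : Exec c s T₁ s₁) :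
    ∀ {s₂ : State} {T₂ : ℕ}, Exec c s T₂ s₂ → T₁ = T₂ ∧ s₁ = s₂ := by
  induction h₁ with
  | nop | assign | write => intro s₂ T₂ h; cases h; exact ⟨rfl, rfl⟩
  | seq _ _ ih₁ ih₂ =>
    intro s₂ T₂ h
    cases h with
    | seq g₁ g₂ =>
      obtain ⟨rfl, rfl⟩ := ih₁ g₁
      obtain ⟨rfl, rfl⟩ := ih₂ g₂
      exact ⟨rfl, rfl⟩
  | ite_true he _ ih =>
    intro s₂ T₂ h
    cases h with
    | ite_true _ g => obtain ⟨rfl, rfl⟩ := ih g; exact ⟨rfl, rfl⟩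
    | ite_false he' _ => exact absurd he' he
  | ite_false he _ ih =>
    intro s₂ T₂ h
    cases h with
    | ite_true he' _ => exact absurd he he'
    | ite_false _ g => obtain ⟨rfl, rfl⟩ := ih g; exact ⟨rfl, rfl⟩
  | loop_true he _ _ ih₁ ih₂ =>
    intro s₂ T₂ h
    cases h with
    | loop_true _ g₁ g₂ =>
      obtain ⟨rfl, rfl⟩ := ih₁ g₁
      obtain ⟨rfl, rfl⟩ := ih₂ g₂
      exact ⟨rfl, rfl⟩
    | loop_false he' => exact absurd he' he
  | loop_false he =>
    intro s₂ T₂ h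
    cases h with
    | loop_true he' _ _ => exact absurd he he'
    | loop_false _ => exact ⟨rfl, rfl⟩

end RAM

/-! ### Fixed-parameter tractability -/

/-- A parameterized decision problem: instances, the way they are written down, the
yes-instances, and the parameter of each instance. -/
structure ParameterizedProblem where
  Inst : Type
  encode : Inst → List ℕ
  encode_injective : Function.Injective encode
  IsYes : Inst → Prop
  param : Inst → ℕ

/-- Fixed-parameter tractability: some program decides every instance `I` in at most
`f (k) * |I| ^ d` steps, where `k` is the parameter of `I`, `|I|` is the input length, `f` is a
computable function and `d` a constant. The answer is yes when variable `0` is nonzero at the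
end. -/
def ParameterizedProblem.IsFPT (Q : ParameterizedProblem) : Prop :=
  ∃ (c : RAM.Program) (f : ℕ → ℕ) (d : ℕ), Computable f ∧
    ∀ I : Q.Inst, ∃ (T : ℕ) (s : RAM.State),
      RAM.Exec c (RAM.initState (Q.encode I)) T s ∧
      T ≤ f (Q.param I) * RAM.inputLength (Q.encode I) ^ d ∧
      (s.var 0 ≠ 0 ↔ Q.IsYes I)

/-- The problem Necessary President for the positional scoring rule `w`, parameterized by the
number of voter types. -/
noncomputable def necessaryPresident (w : ScoringVectors) : ParameterizedProblem where
  Inst := NPInstance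
  encode := NPInstance.encode
  encode_injective := NPInstance.encode_injective
  IsYes I := IsNecessaryPresident w I.election I.party I.p
  param I := I.election.numTypes

/-!
Under a Veto-like rule the points that a nominee `c` obtains from a voter `v` depend only on the
number of nominees that `v` ranks below `c`, cut off at `ℓ` (`IsVetoLike.eq_min`; when there are at
most `ℓ` parties nothing is cut off, so that the arbitrary scoring vectors for few candidates need
no separate treatment). Hence `p` fails to be a necessary president iff, for some rival `d`, there
is a choice of nominees including `p` and `d` under which the numbers of nominees below `p` and
below `d`, one pair of cut-off counters for each voter, give `d` more points than `p`
(`NPInstance.isNecessaryPresident_iff`).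

For a fixed rival, the counter states that can arise are computed by dynamic programming over the
parties: a state reachable for the first `k` parties is advanced by each eligible candidate of
party `k`. Voters of the same type always have the same counters, and so at most
`((ℓ + 1) ^ 2) ^ τ` states are reachable (`NPInstance.length_le_of_reachable`). The program keeps
one pair of counters for every single voter and never computes the types; they only enter the
analysis, through the lengths of the duplicate-free lists of states. A duplicate is found by
comparing a new state with all states stored so far, which makes the running time
`O(M ^ 2 * |I| ^ 4)`, with `M` the bound on the number of states. Points are turned into natural
numbers by an increasing affine transformation (`NPInstance.exists_natTable`) and are stored in a
table that is part of the program.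

Programs are verified with total-correctness triples with a time bound (`RAM.RunsTo`). Variables
and arrays that a program text does not assign to are unchanged (`RAM.Exec.frame`), which reduces
each loop invariant to the few cells that the loop is about.
-/

namespace RAM

/-! ### Reasoning about programs and their running times -/

/-- Whether the text of a program contains an assignment to variable `x`. -/
def Program.modVar : Program → ℕ → Bool
  | nop, _ => false
  | assign y _, x => y == x
  | write _ _ _, _ => false
  | seq c₁ c₂, x => c₁.modVar x || c₂.modVar x
  | ite _ c₁ c₂, x => c₁.modVar x || c₂.modVar x
  | loop _ c, x => c.modVar x

/-- Whether the text of a program contains a write to array `a`. -/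
def Program.modArr : Program → ℕ → Bool
  | nop, _ => false
  | assign _ _, _ => false
  | write b _ _, a => b == a
  | seq c₁ c₂, a => c₁.modArr a || c₂.modArr a
  | ite _ c₁ c₂, a => c₁.modArr a || c₂.modArr a
  | loop _ c, a => c.modArr a

/-- `s` and `s'` agree on all variables and arrays that do not occur on the left-hand side of an
assignment in `c`. For a concrete program the side conditions hold by computation (`rfl`). -/
structure Frame (c : Program) (s s' : State) : Prop where
  var : ∀ x, c.modVar x = false → s'.var x = s.var x
  arr : ∀ a, c.modArr a = false → s'.arr a = s.arr a

theorem Frame.refl (c : Program) (s : State) : Frame c s s := ⟨fun _ _ => rfl, fun _ _ => rfl⟩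

theorem Frame.trans {c : Program} {s s' s'' : State} (h : Frame c s s') (h' : Frame c s' s'') :
    Frame c s s'' :=
  ⟨fun x hx => (h'.var x hx).trans (h.var x hx), fun a ha => (h'.arr a ha).trans (h.arr a ha)⟩

theorem Frame.of_le {c c' : Program} {s s' : State} (h : Frame c s s')
    (hv : ∀ x, c'.modVar x = false → c.modVar x = false)
    (ha : ∀ a, c'.modArr a = false → c.modArr a = false) : Frame c' s s' :=
  ⟨fun x hx => h.var x (hv x hx), fun a h' => h.arr a (ha a h')⟩

/-- Running a program changes only what its text assigns to. -/
theorem Exec.frame {c : Program} {s s' : State} {T : ℕ} (h : Exec c s T s') : Frame c s s' := by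
  induction h with
  | nop s => exact Frame.refl _ s
  | assign x e s =>
    refine ⟨fun y hy => ?_, fun _ _ => rfl⟩
    have : y ≠ x := by rintro rfl; simp [Program.modVar] at hy
    simp [this]
  | write a i e s =>
    refine ⟨fun _ _ => rfl, fun y hy => ?_⟩
    have : y ≠ a := by rintro rfl; simp [Program.modArr] at hy
    simp [this]
  | seq _ _ ih₁ ih₂ =>
    exact (ih₁.of_le (fun x hx => by simp_all [Program.modVar])
      (fun x hx => by simp_all [Program.modArr])).trans
      (ih₂.of_le (fun x hx => by simp_all [Program.modVar])
      (fun x hx => by simp_all [Program.modArr]))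
  | ite_true _ _ ih =>
    exact ih.of_le (fun x hx => by simp_all [Program.modVar])
      (fun x hx => by simp_all [Program.modArr])
  | ite_false _ _ ih =>
    exact ih.of_le (fun x hx => by simp_all [Program.modVar])
      (fun x hx => by simp_all [Program.modArr])
  | loop_true _ _ _ ih₁ ih₂ =>
    exact (ih₁.of_le (fun x hx => by simpa [Program.modVar] using hx)
      (fun x hx => by simpa [Program.modArr] using hx)).trans ih₂
  | loop_false _ => exact Frame.refl _ _

/-- `RunsTo c s B R`: program `c`, started in state `s`, halts after at most `B` steps in a state
that satisfies `R`. -/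
def RunsTo (c : Program) (s : State) (B : ℕ) (R : State → Prop) : Prop :=
  ∃ T s', Exec c s T s' ∧ T ≤ B ∧ R s'

namespace RunsTo

variable {c c₁ c₂ : Program} {e : Expr} {s : State} {B B₁ B₂ : ℕ} {R R' R₁ : State → Prop}

theorem mono (h : RunsTo c s B₁ R) (hB : B₁ ≤ B) : RunsTo c s B R := by
  obtain ⟨T, s', hE, hT, hR⟩ := h
  exact ⟨T, s', hE, hT.trans hB, hR⟩

/-- Weakening the postcondition; everything the program text does not modify is known to be
unchanged. -/
theorem imp (h : RunsTo c s B R) (hR : ∀ s', Frame c s s' → R s' → R' s') : RunsTo c s B R' := by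
  obtain ⟨T, s', hE, hT, h'⟩ := h
  exact ⟨T, s', hE, hT, hR s' hE.frame h'⟩

theorem seq (h₁ : RunsTo c₁ s B₁ R₁)
    (h₂ : ∀ s', Frame c₁ s s' → R₁ s' → RunsTo c₂ s' B₂ R) :
    RunsTo (.seq c₁ c₂) s (B₁ + B₂) R := by
  obtain ⟨T, s', hE, hT, h'⟩ := h₁
  obtain ⟨T', s'', hE', hT', h''⟩ := h₂ s' hE.frame h'
  exact ⟨T + T', s'', hE.seq hE', by omega, h''⟩

theorem nop (h : R s) : RunsTo .nop s 1 R := ⟨1, s, .nop s, le_rfl, h⟩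

theorem assign {x : ℕ} (h : R { s with var := Function.update s.var x (e.eval s) }) :
    RunsTo (.assign x e) s (e.cost + 1) R := ⟨_, _, .assign x e s, le_rfl, h⟩

theorem write {a : ℕ} {i : Expr} (h : R ⟨s.var, Function.update s.arr a
      (Function.update (s.arr a) (i.eval s) (e.eval s))⟩) :
    RunsTo (.write a i e) s (i.cost + e.cost + 1) R := ⟨_, _, .write a i e s, le_rfl, h⟩

theorem assign_seq {x : ℕ}
    (h : RunsTo c { s with var := Function.update s.var x (e.eval s) } B R) :
    RunsTo (.seq (.assign x e) c) s (e.cost + 1 + B) R := by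
  obtain ⟨T, s', hE, hT, h'⟩ := h
  exact ⟨_, s', (Exec.assign x e s).seq hE, by omega, h'⟩

theorem write_seq {a : ℕ} {i : Expr} (h : RunsTo c ⟨s.var, Function.update s.arr a
      (Function.update (s.arr a) (i.eval s) (e.eval s))⟩ B R) :
    RunsTo (.seq (.write a i e) c) s (i.cost + e.cost + 1 + B) R := by
  obtain ⟨T, s', hE, hT, h'⟩ := h
  exact ⟨_, s', (Exec.write a i e s).seq hE, by omega, h'⟩

theorem ite (h₁ : e.eval s ≠ 0 → RunsTo c₁ s B R) (h₂ : e.eval s = 0 → RunsTo c₂ s B R) :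
    RunsTo (.ite e c₁ c₂) s (e.cost + 1 + B) R := by
  by_cases he : e.eval s = 0
  · obtain ⟨T, s', hE, hT, h'⟩ := h₂ he
    exact ⟨_, s', .ite_false he hE, by omega, h'⟩
  · obtain ⟨T, s', hE, hT, h'⟩ := h₁ he
    exact ⟨_, s', .ite_true he hE, by omega, h'⟩

/-- The rule for loops that run exactly `N` times, with an invariant `J i` before round `i` and at
most `B` steps for the body of the loop in each round. -/
theorem loop (J : ℕ → State → Prop) (N : ℕ) (h0 : J 0 s)
    (hstep : ∀ i < N, ∀ s', Frame c s s' → J i s' → e.eval s' ≠ 0 ∧ RunsTo c s' B (J (i + 1)))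
    (hN : ∀ s', Frame c s s' → J N s' → e.eval s' = 0) :
    RunsTo (.loop e c) s (N * (e.cost + 1 + B) + (e.cost + 1)) (J N) := by
  have key : ∀ j i, i + j = N → ∀ s', Frame c s s' → J i s' →
      RunsTo (.loop e c) s' (j * (e.cost + 1 + B) + (e.cost + 1)) (J N) := by
    intro j
    induction j with
    | zero =>
      rintro i rfl s' hF hJ
      exact ⟨_, s', .loop_false (hN s' hF hJ), by omega, hJ⟩
    | succ j ih =>
      intro i hi s' hF hJ
      obtain ⟨he, T, s₁, hE, hT, hJ₁⟩ := hstep i (by omega) s' hF hJ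
      obtain ⟨T', s₂, hE', hT', hJ₂⟩ := ih (i + 1) (by omega) s₁ (hF.trans hE.frame) hJ₁
      refine ⟨_, s₂, .loop_true he hE hE', ?_, hJ₂⟩
      rw [Nat.succ_mul]
      omega
  exact key N 0 (by omega) s (Frame.refl c s) h0

end RunsTo

end RAM

namespace NPInstance

variable (I : NPInstance)

/-! ### Reachable counter states -/

/-- `1` if `v` ranks `c` below `x`, and `0` otherwise. -/
noncomputable def below (x : Fin I.m) (v : Fin I.n) (c : Fin I.m) : ℕ :=
  if I.election.position v x < I.election.position v c then 1 else 0

/-- The counters after one more nominee `c`: for each voter `v`, the first counter is the number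
of nominees below the president candidate `I.p`, the second one the number of nominees below the
rival `d`, both cut off at `ℓ`. -/
noncomputable def advance (ℓ : ℕ) (d c : Fin I.m) (x : Fin I.n → ℕ × ℕ) : Fin I.n → ℕ × ℕ :=
  fun v => (min ℓ ((x v).1 + I.below I.p v c), min ℓ ((x v).2 + I.below d v c))

/-- `c` may be the nominee of party `k` when `I.p` and `d` have to be nominees. -/
def Eligible (d : Fin I.m) (k : ℕ) (c : Fin I.m) : Prop :=
  (I.party c : ℕ) = k ∧ (I.party c = I.party I.p → c = I.p) ∧
    (I.party c = I.party d → c = d)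

/-- The counters that can arise from a choice of the nominees of the first `k` parties. -/
def Reachable (ℓ : ℕ) (d : Fin I.m) : ℕ → (Fin I.n → ℕ × ℕ) → Prop
  | 0, x => x = fun _ => (0, 0)
  | k + 1, x => ∃ c y, I.Eligible d k c ∧ Reachable ℓ d k y ∧ x = I.advance ℓ d c y

variable {I} {ℓ : ℕ} {d : Fin I.m} {k : ℕ} {x : Fin I.n → ℕ × ℕ}

theorem Reachable.le (h : I.Reachable ℓ d k x) (v : Fin I.n) : (x v).1 ≤ ℓ ∧ (x v).2 ≤ ℓ := by
  cases k with
  | zero => rw [Reachable] at h; subst h; simp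
  | succ k =>
    obtain ⟨c, y, -, -, rfl⟩ := h
    exact ⟨min_le_left _ _, min_le_left _ _⟩

theorem position_congr {v v' : Fin I.n} (h : I.election.pref v = I.election.pref v')
    (c : Fin I.m) : I.election.position v c = I.election.position v' c := by
  unfold Election.position
  rw [h]

theorem Reachable.congr (h : I.Reachable ℓ d k x) {v v' : Fin I.n}
    (hv : I.election.pref v = I.election.pref v') : x v = x v' := by
  induction k generalizing x with
  | zero => rw [Reachable] at h; subst h; rfl
  | succ k ih =>
    obtain ⟨c, y, -, hy, rfl⟩ := h
    simp only [advance, below, ih hy, position_congr hv]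

/-- Counters are at most `ℓ` and agree on voters of the same type, so that the number of
reachable counter states is bounded in terms of `ℓ` and the number of types. -/
theorem length_le_of_reachable {L : List (Fin I.n → ℕ × ℕ)} (hL : L.Nodup)
    (h : ∀ x ∈ L, I.Reachable ℓ d k x) :
    L.length ≤ ((ℓ + 1) ^ 2) ^ I.election.numTypes := by
  classical
  have : Fintype (Set.range I.election.pref) := Fintype.ofFinite _
  choose r hr using fun P : Set.range I.election.pref => P.2
  have hcard : (Fintype.piFinset fun _ : Set.range I.election.pref =>
      Finset.range (ℓ + 1) ×ˢ Finset.range (ℓ + 1)).card =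
      ((ℓ + 1) ^ 2) ^ I.election.numTypes := by
    rw [Fintype.card_piFinset]
    simp only [Finset.card_product, Finset.card_range, Finset.prod_const, Finset.card_univ]
    rw [Election.numTypes, Set.ncard_eq_toFinset_card', Set.toFinset_card, sq]
  rw [← hcard, ← List.toFinset_card_of_nodup hL]
  -- A state is determined by its counters on one representative `r P` of each type `P`.
  refine Finset.card_le_card_of_injOn (fun x P => x (r P)) (fun x hx => ?_)
    (fun x hx y hy hxy => ?_)
  · have hx' := h x (by simpa using hx)
    simp only [Finset.mem_coe, Fintype.mem_piFinset, Finset.mem_product, Finset.mem_range]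
    intro P
    have := hx'.le (r P)
    omega
  · have hx' := h x (by simpa using hx)
    have hy' := h y (by simpa using hy)
    funext v
    have hv := hr ⟨_, v, rfl⟩
    rw [← hx'.congr hv, ← hy'.congr hv]
    exact congrFun hxy _

/-- Reachability in terms of choice functions `σ` from parties to nominees. -/
theorem reachable_iff : I.Reachable ℓ d k x ↔ ∃ σ : ℕ → Fin I.m,
    (∀ j < k, I.Eligible d j (σ j)) ∧ ∀ v,
      x v = (min ℓ (∑ j ∈ Finset.range k, I.below I.p v (σ j)),
        min ℓ (∑ j ∈ Finset.range k, I.below d v (σ j))) := by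
  induction k generalizing x with
  | zero =>
    simp only [Reachable, not_lt_zero, false_imp_iff, implies_true, true_and, Finset.range_zero,
      Finset.sum_empty, min_eq_right, zero_le]
    exact ⟨fun h => ⟨fun _ => I.p, fun v => by rw [h]⟩, fun ⟨_, h⟩ => funext h⟩
  | succ k ih =>
    constructor
    · rintro ⟨c, y, hc, hy, rfl⟩
      obtain ⟨σ, hσ, hyσ⟩ := ih.1 hy
      have hne : ∀ j ∈ Finset.range k, Function.update σ k c j = σ j := fun j hj =>
        Function.update_of_ne (by simp at hj; omega) _ _
      refine ⟨Function.update σ k c, fun j hj => ?_, fun v => ?_⟩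
      · rcases Nat.lt_succ_iff_lt_or_eq.1 hj with h | rfl
        · rw [hne j (by simpa using h)]
          exact hσ j h
        · simpa using hc
      · rw [Finset.sum_range_succ, Finset.sum_range_succ, Function.update_self,
          Finset.sum_congr rfl fun j hj => congrArg (I.below I.p v) (hne j hj),
          Finset.sum_congr rfl fun j hj => congrArg (I.below d v) (hne j hj), advance, hyσ]
        ext <;> simp only <;> omega
    · rintro ⟨σ, hσ, hx⟩
      refine ⟨σ k, _, hσ k (by omega), ih.2 ⟨σ, fun j hj => hσ j (by omega), fun v => rfl⟩, ?_⟩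
      funext v
      rw [hx, Finset.sum_range_succ, Finset.sum_range_succ]
      ext <;> simp only [advance] <;> omega

/-! ### Scores in reduced elections -/

theorem card_nomination {S : Finset (Fin I.m)} (hS : IsNomination I.party S) :
    S.card = I.t := by
  have : S.card = (Finset.univ : Finset (Fin I.t)).card := by
    refine Finset.card_bij (fun c _ => I.party c) (fun _ _ => Finset.mem_univ _) ?_ ?_
    · intro c hc c' hc' h
      exact (hS (I.party c)).unique ⟨hc, rfl⟩ ⟨hc', h.symm⟩
    · intro j _
      obtain ⟨c, ⟨hc, hj⟩, -⟩ := hS j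
      exact ⟨c, hc, hj⟩
  simpa using this

/-- In a reduced election the position of a nominee is determined by the number of nominees
below it. -/
theorem position_restrict {S : Finset (Fin I.m)} (hS : IsNomination I.party S) {c : Fin I.m}
    (hc : c ∈ S) (v : Fin I.n) :
    (I.election.restrict S).position v ⟨c, hc⟩ + 1 + ∑ e ∈ S, I.below c v e = I.t := by
  classical
  have h1 : (I.election.restrict S).position v ⟨c, hc⟩ =
      (S.filter fun e => I.election.position v e < I.election.position v c).card := by
    have : Subtype.val '' {e : S | (I.election.restrict S).pref v e ⟨c, hc⟩} =
        ((S.filter fun e => I.election.position v e < I.election.position v c :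
          Finset (Fin I.m)) : Set (Fin I.m)) := by
      ext e
      simp [Election.restrict, ← Election.pref_iff_position_lt, and_comm]
    rw [Election.position, ← Set.ncard_coe_finset, ← this,
      Set.ncard_image_of_injective _ Subtype.val_injective]
  have h2 : ∑ e ∈ S, I.below c v e =
      (S.filter fun e => I.election.position v c < I.election.position v e).card := by
    simp only [below, Finset.card_filter]
  have h3 : (S.filter fun e => I.election.position v e = I.election.position v c).card = 1 := by
    rw [Finset.card_eq_one]
    refine ⟨c, ?_⟩
    ext e
    simp only [Finset.mem_filter, Finset.mem_singleton]
    constructor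
    · rintro ⟨-, h⟩
      refine (I.election.strict v).trichotomous e c ?_ ?_ <;>
        · rw [Election.pref_iff_position_lt]
          omega
    · rintro rfl
      exact ⟨hc, rfl⟩
  -- Each nominee is above `c`, below `c`, or `c` itself.
  rw [h1, h2, ← card_nomination hS]
  nth_rw 1 [← h3]
  rw [Finset.card_filter, Finset.card_filter, Finset.card_filter, ← Finset.sum_add_distrib,
    ← Finset.sum_add_distrib, Finset.card_eq_sum_ones]
  refine Finset.sum_congr rfl fun e _ => ?_
  split_ifs <;> omega

theorem score_restrict (w : ScoringVectors) {S : Finset (Fin I.m)}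
    (hS : IsNomination I.party S) {c : Fin I.m} (hc : c ∈ S) :
    (I.election.restrict S).score w ⟨c, hc⟩ =
      ∑ v, w I.t (I.t - 1 - ∑ e ∈ S, I.below c v e) := by
  rw [Election.score]
  refine Finset.sum_congr rfl fun v _ => ?_
  rw [Fintype.card_coe, card_nomination hS]
  congr 1
  have := position_restrict hS hc v
  omega

/-- For a Veto-like rule, a candidate with `β` nominees below it obtains points that depend only
on `min β ℓ` and on `min t (ℓ + 1)`. This includes the case `t ≤ ℓ`, where nothing is cut off. -/
theorem _root_.IsVetoLike.eq_min {w : ScoringVectors} {ℓ : ℕ} {a : ℚ} {b : Fin ℓ → ℚ}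
    (hw : IsVetoLike w ℓ a b) {t β : ℕ} (hβ : β < t) :
    w t (t - 1 - β) = w (min t (ℓ + 1)) (min t (ℓ + 1) - 1 - min ℓ β) := by
  rcases Nat.lt_or_ge ℓ t with ht | ht
  · have key : ∀ t, ℓ < t → ∀ β < t, w t (t - 1 - β) =
        if h : β < ℓ then b ⟨ℓ - 1 - β, by omega⟩ else a := by
      intro t ht β hβ
      split_ifs with h
      · rw [← (hw t ht).2]
        congr 1
        simp only
        omega
      · exact (hw t ht).1 _ (by omega)
    rw [min_eq_right (by omega : ℓ + 1 ≤ t), key t ht β hβ,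
      key (ℓ + 1) (by omega) (min ℓ β) (by omega)]
    rcases Nat.lt_or_ge β ℓ with h | h
    · simp [min_eq_right h.le]
    · simp [h, Nat.not_lt.2 h]
  · rw [min_eq_left (by omega), min_eq_right (by omega)]

/-- The candidate `I.p` is a necessary president iff no rival `d` obtains a higher score under
counters that are reachable once all parties have chosen their nominees. -/
theorem isNecessaryPresident_iff {w : ScoringVectors} {ℓ : ℕ} {a : ℚ} {b : Fin ℓ → ℚ}
    (hw : IsVetoLike w ℓ a b) :
    IsNecessaryPresident w I.election I.party I.p ↔ ∀ d x, I.Reachable ℓ d I.t x →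
      ∑ v, w (min I.t (ℓ + 1)) (min I.t (ℓ + 1) - 1 - (x v).2) ≤
        ∑ v, w (min I.t (ℓ + 1)) (min I.t (ℓ + 1) - 1 - (x v).1) := by
  classical
  have hscore : ∀ {S : Finset (Fin I.m)} (hS : IsNomination I.party S) {c} (hc : c ∈ S),
      (I.election.restrict S).score w ⟨c, hc⟩ = ∑ v, w (min I.t (ℓ + 1))
        (min I.t (ℓ + 1) - 1 - min ℓ (∑ e ∈ S, I.below c v e)) := by
    intro S hS c hc
    rw [score_restrict w hS hc]
    refine Finset.sum_congr rfl fun v _ => hw.eq_min ?_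
    have := position_restrict hS hc v
    omega
  constructor
  · intro h d x hx
    obtain ⟨σ, hσ, hxσ⟩ := reachable_iff.1 hx
    have hinj : Set.InjOn σ (Finset.range I.t : Set ℕ) := by
      intro i hi j hj hij
      rw [← (hσ i (by simpa using hi)).1, ← (hσ j (by simpa using hj)).1, hij]
    set S := (Finset.range I.t).image σ with hSdef
    have hS : IsNomination I.party S := by
      intro j
      refine ⟨σ j, ⟨?_, Fin.ext (hσ j j.2).1⟩, ?_⟩
      · exact Finset.mem_image_of_mem _ (by simp)
      · rintro c ⟨hc, hj⟩
        obtain ⟨i, hi, rfl⟩ := Finset.mem_image.1 hc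
        rw [← hj, (hσ i (by simpa using hi)).1]
    have hp : I.p ∈ S := by
      have hσp := hσ _ (I.party I.p).2
      rw [← hσp.2.1 (Fin.ext hσp.1)]
      exact Finset.mem_image_of_mem _ (by simp)
    have hd : d ∈ S := by
      have hσd := hσ _ (I.party d).2
      rw [← hσd.2.2 (Fin.ext hσd.1)]
      exact Finset.mem_image_of_mem _ (by simp)
    have := h S hS hp ⟨d, hd⟩
    rw [hscore hS hp, hscore hS hd] at this
    simpa only [hSdef, Finset.sum_image hinj, hxσ] using this
  · rintro h S hS hp ⟨d, hd⟩
    choose τ hτ hτ' using id hS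
    have hinv : ∀ c ∈ S, τ (I.party c) = c := fun c hc => (hτ' _ c ⟨hc, rfl⟩).symm
    rw [hscore hS hp, hscore hS hd]
    -- `reachable_iff` wants a choice function on `ℕ`; its values from `I.t` on do not matter.
    have hsum : ∀ f : Fin I.m → ℕ, ∑ j ∈ Finset.range I.t,
        f (if h : j < I.t then τ ⟨j, h⟩ else I.p) = ∑ e ∈ S, f e := by
      intro f
      rw [Finset.sum_range fun j => f (if h : j < I.t then τ ⟨j, h⟩ else I.p)]
      refine Finset.sum_bij (fun j _ => τ j) (fun j _ => (hτ j).1) ?_ ?_ ?_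
      · intro i _ j _ h
        rw [← (hτ i).2, h, (hτ j).2]
      · exact fun c hc => ⟨I.party c, Finset.mem_univ _, hinv c hc⟩
      · intro j _
        rw [dif_pos j.2]
    have hreach : I.Reachable ℓ d I.t fun v =>
        (min ℓ (∑ e ∈ S, I.below I.p v e), min ℓ (∑ e ∈ S, I.below d v e)) := by
      refine reachable_iff.2 ⟨fun j => if h : j < I.t then τ ⟨j, h⟩ else I.p, ?_,
        fun v => by rw [hsum, hsum]⟩
      intro j hj
      simp only [hj, dite_true]
      have hj' := (hτ ⟨j, hj⟩).2
      exact ⟨by rw [hj'], fun hp' => by rw [← hj', hp', hinv _ hp],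
        fun hd' => by rw [← hj', hd', hinv _ hd]⟩
    have := h d _ hreach
    simpa only using this

/-- The finitely many relevant points of a positional scoring rule are, up to a common increasing
affine transformation, natural numbers. -/
theorem exists_natTable (w : ScoringVectors) (ℓ : ℕ) : ∃ (tab : ℕ → ℕ → ℕ) (D K : ℚ), 0 < D ∧
    ∀ T ≤ ℓ + 1, ∀ β ≤ ℓ, (tab T β : ℚ) = D * w T (T - 1 - β) + K := by
  classical
  set F : Finset ℚ := (Finset.range (ℓ + 2) ×ˢ Finset.range (ℓ + 1)).image
    fun q => w q.1 (q.1 - 1 - q.2) with hF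
  -- The product of all denominators, and a shift that makes all values nonnegative.
  set D : ℕ := ∏ q ∈ F, q.den with hD
  have hD0 : 0 < D := Finset.prod_pos fun q _ => q.den_pos
  have hint : ∀ q ∈ F, ∃ z : ℤ, (z : ℚ) = D * q := by
    intro q hq
    obtain ⟨e, he⟩ : q.den ∣ D := Finset.dvd_prod_of_mem _ hq
    refine ⟨e * q.num, ?_⟩
    rw [he]
    push_cast
    rw [← Rat.mul_den_eq_num]
    ring
  choose! z hz using hint
  set K : ℤ := ∑ q ∈ F, |z q| with hK
  refine ⟨fun T β => (z (w T (T - 1 - β)) + K).toNat, D, K, by exact_mod_cast hD0, ?_⟩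
  intro T hT β hβ
  have hmem : w T (T - 1 - β) ∈ F :=
    Finset.mem_image.2 ⟨(T, β), by simp; omega, rfl⟩
  have h1 : |z (w T (T - 1 - β))| ≤ K :=
    Finset.single_le_sum (f := fun q => |z q|) (fun _ _ => abs_nonneg _) hmem
  have h2 := neg_abs_le (z (w T (T - 1 - β)))
  have h3 : ((z (w T (T - 1 - β)) + K).toNat : ℤ) = z (w T (T - 1 - β)) + K :=
    Int.toNat_of_nonneg (by omega)
  rw [← hz _ hmem]
  exact_mod_cast h3

/-! ### The encoding of an instance -/

theorem encode_getD :
    I.encode.getD 0 0 = I.m ∧ I.encode.getD 1 0 = I.n ∧ I.encode.getD 2 0 = I.t ∧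
      I.encode.getD 3 0 = I.p := by
  simp [encode]

theorem encode_getD_party (c : Fin I.m) : I.encode.getD (4 + c) 0 = I.party c := by
  rw [encode, List.getD_append _ _ _ _ (by simp; omega),
    List.getD_append_right _ _ _ _ (by simp)]
  simp [List.getD_eq_getElem?_getD]

theorem _root_.List.getD_flatten_ofFn {n m : ℕ} (f : Fin n → Fin m → ℕ) (i : Fin n)
    (j : Fin m) : (List.ofFn fun i => List.ofFn (f i)).flatten.getD (i * m + j) 0 = f i j := by
  induction n with
  | zero => exact i.elim0
  | succ n ih =>
    rw [List.ofFn_succ, List.flatten_cons]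
    induction i using Fin.cases with
    | zero =>
      rw [List.getD_append _ _ _ _ (by simp)]
      simp [List.getD_eq_getElem?_getD]
    | succ i =>
      rw [List.getD_append_right _ _ _ _ (by simp [Nat.succ_mul]; omega), ← ih fun i => f i.succ]
      congr 1
      simp [Nat.succ_mul]
      omega

theorem encode_getD_position (v : Fin I.n) (c : Fin I.m) :
    I.encode.getD (4 + I.m + v * I.m + c) 0 = I.election.position v c := by
  rw [encode, List.getD_append_right _ _ _ _ (by simp; omega),
    ← List.getD_flatten_ofFn I.election.position]
  congr 1
  simp
  omega

/-- The encoding has `4 + m + n * m` entries, and each entry contributes to the length. Here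
`n ≤ n * m` because `I.p` is a candidate, and `t ≤ m` because no party is empty. -/
theorem lt_inputLength :
    I.m < RAM.inputLength I.encode ∧ I.n < RAM.inputLength I.encode ∧
      I.t < RAM.inputLength I.encode := by
  have h1 : I.encode.length ≤ RAM.inputLength I.encode := by
    rw [RAM.inputLength]
    calc I.encode.length = (I.encode.map fun _ => 1).sum := by simp
      _ ≤ _ := List.sum_le_sum fun _ _ => by omega
  have h2 : I.encode.length = 4 + I.m + I.n * I.m := by
    simp [encode, Function.comp_def]
    omega
  have h3 : I.t ≤ I.m := by
    simpa using Fintype.card_le_of_surjective _ I.party_surjective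
  have h4 : I.n * 1 ≤ I.n * I.m := Nat.mul_le_mul_left _ I.p.pos
  omega

end NPInstance

namespace RAM

/-! ### The program -/

/-! Conventions. Array `0` is the input: cells `0` to `3` hold `m`, `n`, `t` and `p`, the party of
candidate `c` is in cell `4 + c`, and its position for voter `v` in cell `4 + m + v * m + c`.
Arrays `1` and `2` hold the counter states, array `3` the table of points.

The variables are: `0` the answer, `1` the rival, `2` the party, `3` the candidate, `4` and `5` the
addresses of blocks, `6` the voter, `7` the address of the positions of this voter, `8` the end of
the next layer, `9` its start and the end of the current layer, `10` the start of the current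
layer, `11` and `12` flags, `13` and `14` the scores of `p` and of the rival. -/

/-- `1` if the two values differ, and `0` otherwise. -/
def Expr.ne (e₁ e₂ : Expr) : Expr := .add (.lt e₁ e₂) (.lt e₂ e₁)

/-- The minimum of `ℓ` and the value of `e`. -/
def Expr.cap (ℓ : ℕ) (e : Expr) : Expr := .sub e (.sub e (.const ℓ))

theorem Expr.eval_ne (e₁ e₂ : Expr) (s : State) :
    (Expr.ne e₁ e₂).eval s = if e₁.eval s = e₂.eval s then 0 else 1 := by
  simp only [Expr.ne, Expr.eval]
  split_ifs <;> omega

theorem Expr.eval_cap (ℓ : ℕ) (e : Expr) (s : State) :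
    (Expr.cap ℓ e).eval s = min ℓ (e.eval s) := by
  simp only [Expr.cap, Expr.eval]
  omega

/-- The loop over all voters in `extend`. -/
def extendLoop (ℓ : ℕ) : Program :=
  .loop (.lt (.var 6) (.read 0 (.const 1)))
    (.seq (.write 1 (.add (.var 8) (.var 6)) (.cap ℓ (.add (.read 1 (.add (.var 4) (.var 6)))
        (.lt (.read 0 (.add (.var 7) (.read 0 (.const 3))))
          (.read 0 (.add (.var 7) (.var 3)))))))
    (.seq (.write 2 (.add (.var 8) (.var 6)) (.cap ℓ (.add (.read 2 (.add (.var 4) (.var 6)))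
        (.lt (.read 0 (.add (.var 7) (.var 1)))
          (.read 0 (.add (.var 7) (.var 3)))))))
    (.seq (.assign 7 (.add (.var 7) (.read 0 (.const 0))))
      (.assign 6 (.add (.var 6) (.const 1))))))

/-- Write the block at address `var 4`, advanced by candidate `var 3`, to address `var 8`. -/
def extend (ℓ : ℕ) : Program :=
  .seq (.assign 6 (.const 0))
    (.seq (.assign 7 (.add (.const 4) (.read 0 (.const 0)))) (extendLoop ℓ))

/-- Variable `12` becomes nonzero iff the blocks at addresses `var 5` and `var 8` differ. -/
def compare : Program :=
  .seq (.assign 12 (.const 0)) (.seq (.assign 6 (.const 0))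
    (.loop (.lt (.var 6) (.read 0 (.const 1)))
      (.seq (.assign 12 (.add (.var 12) (.add
        (.ne (.read 1 (.add (.var 5) (.var 6))) (.read 1 (.add (.var 8) (.var 6))))
        (.ne (.read 2 (.add (.var 5) (.var 6))) (.read 2 (.add (.var 8) (.var 6)))))))
        (.assign 6 (.add (.var 6) (.const 1))))))

/-- The distance between consecutive blocks is the number of voters plus one; it is positive even
if there are no voters. -/
def stride : Expr := .add (.read 0 (.const 1)) (.const 1)

/-- Variable `11` becomes nonzero iff the block at address `var 8` is among those stored between
the addresses `var 9` and `var 8`. -/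
def search : Program :=
  .seq (.assign 11 (.const 0)) (.seq (.assign 5 (.var 9))
    (.loop (.lt (.var 5) (.var 8))
      (.seq compare (.seq (.assign 11 (.add (.var 11) (.sub (.const 1) (.var 12))))
        (.assign 5 (.add (.var 5) stride))))))

/-- Advance the block at address `var 4` by candidate `var 3`, and append the outcome to the
blocks between the addresses `var 9` and `var 8` unless it is there already. -/
def insert (ℓ : ℕ) : Program :=
  .seq (extend ℓ) (.seq search
    (.ite (.var 11) .nop (.assign 8 (.add (.var 8) stride))))

/-- Insert the successors, under candidate `var 3`, of all blocks of the current layer, which is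
stored between the addresses `var 10` and `var 9`. -/
def grow (ℓ : ℕ) : Program :=
  .seq (.assign 4 (.var 10)) (.loop (.lt (.var 4) (.var 9))
    (.seq (insert ℓ) (.assign 4 (.add (.var 4) stride))))

/-- The party of the candidate given by `e`. -/
def partyOf (e : Expr) : Expr := .read 0 (.add (.const 4) e)

/-- Nonzero iff candidate `var 3` does not belong to party `var 2`, or belongs to the same party
as, but is different from, the candidate in cell `3` of the input or the candidate `var 1`. -/
def ineligible : Expr :=
  .add (.ne (partyOf (.var 3)) (.var 2)) (.add
    (.lt (.ne (partyOf (.var 3)) (partyOf (.read 0 (.const 3))))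
      (.ne (.var 3) (.read 0 (.const 3))))
    (.lt (.ne (partyOf (.var 3)) (partyOf (.var 1))) (.ne (.var 3) (.var 1))))

/-- Compute the next layer between the addresses `var 9` and `var 8`, using all eligible
candidates of party `var 2`. -/
def nextLayer (ℓ : ℕ) : Program :=
  .seq (.assign 8 (.var 9)) (.seq (.assign 3 (.const 0))
    (.loop (.lt (.var 3) (.read 0 (.const 0)))
      (.seq (.ite ineligible .nop (grow ℓ)) (.assign 3 (.add (.var 3) (.const 1))))))

/-- Write a block of zeros to address `0`. -/
def zeroBlock : Program :=
  .seq (.assign 6 (.const 0)) (.loop (.lt (.var 6) (.read 0 (.const 1)))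
    (.seq (.write 1 (.var 6) (.const 0)) (.seq (.write 2 (.var 6) (.const 0))
      (.assign 6 (.add (.var 6) (.const 1))))))

/-- Compute all layers for the rival `var 1`; only the last one is kept track of. -/
def allLayers (ℓ : ℕ) : Program :=
  .seq zeroBlock (.seq (.assign 10 (.const 0)) (.seq (.assign 9 stride)
    (.seq (.assign 2 (.const 0)) (.loop (.lt (.var 2) (.read 0 (.const 2)))
      (.seq (nextLayer ℓ) (.seq (.assign 10 (.var 9)) (.seq (.assign 9 (.var 8))
        (.assign 2 (.add (.var 2) (.const 1))))))))))

/-- Sum the points (array `3`) for the first and the second counters of the block at address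
`var 4`. -/
def addScores : Program :=
  .seq (.assign 13 (.const 0)) (.seq (.assign 14 (.const 0)) (.seq (.assign 6 (.const 0))
    (.loop (.lt (.var 6) (.read 0 (.const 1)))
      (.seq (.assign 13 (.add (.var 13) (.read 3 (.read 1 (.add (.var 4) (.var 6))))))
      (.seq (.assign 14 (.add (.var 14) (.read 3 (.read 2 (.add (.var 4) (.var 6))))))
        (.assign 6 (.add (.var 6) (.const 1))))))))

/-- Set the answer to `0` if the rival obtains a higher score for some block of the current
layer. -/
def judge : Program :=
  .seq (.assign 4 (.var 10)) (.loop (.lt (.var 4) (.var 9))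
    (.seq addScores (.seq (.ite (.lt (.var 13) (.var 14)) (.assign 0 (.const 0)) .nop)
      (.assign 4 (.add (.var 4) stride)))))

/-- Write the first `k` values of `g` to array `3`. -/
def writeTable (g : ℕ → ℕ) : ℕ → Program
  | 0 => .nop
  | k + 1 => .seq (writeTable g k) (.write 3 (.const k) (.const (g k)))

/-- Write the table of points for `min t T` candidates, where `t` is the number of parties. -/
def selectTable (tab : ℕ → ℕ → ℕ) (ℓ : ℕ) : ℕ → Program
  | 0 => writeTable (tab 0) (ℓ + 1)
  | T + 1 => .ite (.lt (.const T) (.read 0 (.const 2)))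
      (writeTable (tab (T + 1)) (ℓ + 1)) (selectTable tab ℓ T)

/-- The decision procedure: it computes the layers of reachable counter states for each rival and
compares the scores. -/
def decideNP (tab : ℕ → ℕ → ℕ) (ℓ : ℕ) : Program :=
  .seq (selectTable tab ℓ (ℓ + 1)) (.seq (.assign 0 (.const 1)) (.seq (.assign 1 (.const 0))
    (.loop (.lt (.var 1) (.read 0 (.const 0)))
      (.seq (allLayers ℓ) (.seq judge (.assign 1 (.add (.var 1) (.const 1))))))))

/-! ### Counter states in memory -/

/-- The counter state stored at address `b`: first counters in array `1`, second ones in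
array `2`. -/
def State.block (s : State) (n b : ℕ) : Fin n → ℕ × ℕ :=
  fun v => (s.arr 1 (b + v), s.arr 2 (b + v))

/-- The list of `len` blocks stored from address `lo` on. -/
def State.blocks (s : State) (n lo len : ℕ) : List (Fin n → ℕ × ℕ) :=
  (List.range len).map fun i => s.block n (lo + i * (n + 1))

/-- The blocks between the addresses `lo` and `hi` list the elements of `A` without repetition.
Blocks are `n + 1` cells apart, so that `lo` and `hi` determine their number even if `n = 0`. -/
def Stores (s : State) (n lo hi : ℕ) (A : Set (Fin n → ℕ × ℕ)) : Prop :=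
  ∃ len, hi = lo + len * (n + 1) ∧ (s.blocks n lo len).Nodup ∧ ∀ x, x ∈ s.blocks n lo len ↔ x ∈ A

/-- `s` and `s'` agree on the cells of the arrays `1` and `2` below address `b`. -/
def SameBelow (s s' : State) (b : ℕ) : Prop :=
  ∀ i < b, s'.arr 1 i = s.arr 1 i ∧ s'.arr 2 i = s.arr 2 i

theorem SameBelow.refl (s : State) (b : ℕ) : SameBelow s s b := fun _ _ => ⟨rfl, rfl⟩

theorem SameBelow.trans {s s' s'' : State} {b : ℕ} (h : SameBelow s s' b)
    (h' : SameBelow s' s'' b) : SameBelow s s'' b :=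
  fun i hi => ⟨(h' i hi).1.trans (h i hi).1, (h' i hi).2.trans (h i hi).2⟩

theorem SameBelow.mono {s s' : State} {b b' : ℕ} (h : SameBelow s s' b) (hb : b' ≤ b) :
    SameBelow s s' b' := fun i hi => h i (hi.trans_le hb)

theorem SameBelow.block_eq {s s' : State} {b n lo : ℕ} (h : SameBelow s s' b)
    (hlo : lo + n ≤ b) : s'.block n lo = s.block n lo := by
  funext v
  have := h (lo + v) (by omega)
  simp [State.block, this]

theorem SameBelow.blocks_eq {s s' : State} {b n lo len : ℕ} (h : SameBelow s s' b)
    (hlo : lo + len * (n + 1) ≤ b) : s'.blocks n lo len = s.blocks n lo len := by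
  refine List.map_congr_left fun i hi => h.block_eq ?_
  have h1 : (i + 1) * (n + 1) ≤ len * (n + 1) := Nat.mul_le_mul_right _ (by simpa using hi)
  rw [Nat.succ_mul] at h1
  omega

theorem SameBelow.stores {s s' : State} {b n lo hi : ℕ} {A : Set (Fin n → ℕ × ℕ)}
    (h : SameBelow s s' b) (hhi : hi ≤ b) (hS : Stores s n lo hi A) : Stores s' n lo hi A := by
  obtain ⟨len, rfl, h1, h2⟩ := hS
  exact ⟨len, rfl, by rwa [h.blocks_eq hhi], by rwa [h.blocks_eq hhi]⟩

theorem State.mem_blocks {s : State} {n lo len : ℕ} {x : Fin n → ℕ × ℕ} :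
    x ∈ s.blocks n lo len ↔ ∃ i < len, s.block n (lo + i * (n + 1)) = x := by
  simp [State.blocks]

theorem State.blocks_succ (s : State) (n lo len : ℕ) :
    s.blocks n lo (len + 1) = s.blocks n lo len ++ [s.block n (lo + len * (n + 1))] := by
  simp [State.blocks, List.range_succ]

theorem Stores.empty (s : State) (n lo : ℕ) : Stores s n lo lo ∅ :=
  ⟨0, by simp [State.blocks]⟩

/-- Running times of loops: `N` rounds with running time at most `b * Y` each. -/
theorem loop_bound {N A Y k b B : ℕ} (hN : N ≤ A) (hA : 1 ≤ A) (hY : 1 ≤ Y) (hB : B ≤ b * Y) :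
    N * (k + B) + k ≤ (2 * k + b) * (A * Y) := by
  have hAY : 1 ≤ A * Y := Nat.mul_pos hA hY
  calc N * (k + B) + k ≤ A * (k * Y + b * Y) + k * (A * Y) :=
        add_le_add (Nat.mul_le_mul hN (add_le_add (Nat.le_mul_of_pos_right k hY) hB))
          (Nat.le_mul_of_pos_right k hAY)
    _ = (2 * k + b) * (A * Y) := by ring

/-! ### Correctness and running times of the parts of the program -/

section Parts

variable {I : NPInstance} {ℓ X : ℕ} {s : State} {d c : Fin I.m}

/-- Array `0` holds the encoding of `I`. -/
def HasInput (I : NPInstance) (s : State) : Prop := s.arr 0 = fun i => I.encode.getD i 0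

theorem HasInput.frame {c : Program} {s s' : State} (h : HasInput I s) (hF : Frame c s s')
    (hc : c.modArr 0 = false) : HasInput I s' := (hF.arr 0 hc).trans h

namespace HasInput

variable (h : HasInput I s)

include h

theorem m_eq : s.arr 0 0 = I.m := by rw [h]; exact I.encode_getD.1
theorem n_eq : s.arr 0 1 = I.n := by rw [h]; exact I.encode_getD.2.1
theorem t_eq : s.arr 0 2 = I.t := by rw [h]; exact I.encode_getD.2.2.1
theorem p_eq : s.arr 0 3 = I.p := by rw [h]; exact I.encode_getD.2.2.2
theorem party_eq (c : Fin I.m) : s.arr 0 (4 + c) = I.party c := by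
  rw [h]; exact I.encode_getD_party c
theorem position_eq (v : Fin I.n) (c : Fin I.m) :
    s.arr 0 (4 + I.m + v * I.m + c) = I.election.position v c := by
  rw [h]; exact I.encode_getD_position v c

end HasInput

theorem extend_spec (hX : I.n < X) (hin : HasInput I s) (hd : s.var 1 = d) (hc : s.var 3 = c)
    (hq : s.var 4 + I.n ≤ s.var 8) :
    RunsTo (extend ℓ) s (100 * X) fun s' => SameBelow s s' (s.var 8) ∧
      s'.block I.n (s.var 8) = I.advance ℓ d c (s.block I.n (s.var 4)) := by
  refine (RunsTo.assign_seq (RunsTo.assign_seq ((RunsTo.loop (B := 90)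
    (fun i s' => s'.var 6 = i ∧ s'.var 7 = 4 + I.m + i * I.m ∧
      SameBelow s s' (s.var 8) ∧ ∀ v : Fin I.n, v < i → s'.block I.n (s.var 8) v =
        I.advance ℓ d c (s.block I.n (s.var 4)) v) I.n ?_ ?_ ?_).imp
    fun s' _ h => ⟨h.2.2.1, funext fun v => h.2.2.2 v v.2⟩))).mono ?_
  · exact ⟨rfl, by simp [Expr.eval, hin.m_eq], fun j _ => ⟨rfl, rfl⟩,
      fun v hv => absurd hv (by omega)⟩
  · rintro i hi s' hF ⟨h6, h7, hsame, hblock⟩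
    have hin' : HasInput I s' := (hF.arr 0 rfl).trans hin
    have e1 : s'.var 1 = d := (hF.var 1 rfl).trans hd
    have e3 : s'.var 3 = c := (hF.var 3 rfl).trans hc
    have e4 : s'.var 4 = s.var 4 := hF.var 4 rfl
    have e8 : s'.var 8 = s.var 8 := hF.var 8 rfl
    have hread := hsame (s.var 4 + i) (by omega)
    have hp := hin'.position_eq ⟨i, hi⟩ I.p
    have hc' := hin'.position_eq ⟨i, hi⟩ c
    have hd' := hin'.position_eq ⟨i, hi⟩ d
    simp only at hp hc' hd'
    refine ⟨by simp [Expr.eval, h6, hin'.n_eq, hi], (RunsTo.write_seq (RunsTo.write_seq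
      (RunsTo.assign_seq (RunsTo.assign ?_)))).mono (by simp [Expr.cost, Expr.cap])⟩
    refine ⟨by simp [Expr.eval, h6], ?_, ?_, ?_⟩
    · simp [Expr.eval, h7, hin'.m_eq, Nat.succ_mul, add_assoc]
    · intro j hj
      have hne : j ≠ s.var 8 + i := by omega
      simpa [Expr.eval, Expr.eval_cap, e8, h6, hne] using hsame j hj
    · intro v hv
      rcases Nat.lt_succ_iff_lt_or_eq.1 hv with hv | hv
      · have := hblock v hv
        have hne : (v : ℕ) ≠ i := by omega
        simpa [State.block, Expr.eval, Expr.eval_cap, e8, h6, hne] using this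
      · obtain rfl : v = ⟨i, hi⟩ := Fin.ext hv
        simp [State.block, Expr.eval, Expr.eval_cap, e8, h6, h7, e4, e3, e1, hread,
          hin'.p_eq, hp, hc', hd', NPInstance.advance, NPInstance.below]
  · rintro s' hF ⟨h6, -⟩
    have hin' : HasInput I s' := (hF.arr 0 rfl).trans hin
    simp [Expr.eval, h6, hin'.n_eq]
  · simp only [Expr.cost]
    omega

theorem compare_spec (hX : I.n < X) (hin : HasInput I s) :
    RunsTo compare s (60 * X) fun s' =>
      s'.var 12 = 0 ↔ s.block I.n (s.var 5) = s.block I.n (s.var 8) := by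
  refine (RunsTo.assign_seq (RunsTo.assign_seq ((RunsTo.loop (B := 50)
    (fun i s' => s'.var 6 = i ∧ (s'.var 12 = 0 ↔
      ∀ v : Fin I.n, v < i → s.block I.n (s.var 5) v = s.block I.n (s.var 8) v))
    I.n ?_ ?_ ?_).imp fun s' _ h =>
      h.2.trans ⟨fun h => funext fun v => h v v.2, fun h v _ => by rw [h]⟩))).mono ?_
  · exact ⟨rfl, by simp [Expr.eval]⟩
  · rintro i hi s' hF ⟨h6, hiff⟩
    have hin' : HasInput I s' := (hF.arr 0 rfl).trans hin
    have e5 : s'.var 5 = s.var 5 := hF.var 5 rfl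
    have e8 : s'.var 8 = s.var 8 := hF.var 8 rfl
    have a1 : s'.arr 1 = s.arr 1 := hF.arr 1 rfl
    have a2 : s'.arr 2 = s.arr 2 := hF.arr 2 rfl
    refine ⟨by simp [Expr.eval, h6, hin'.n_eq, hi], (RunsTo.assign_seq
      (RunsTo.assign ?_)).mono (by simp [Expr.cost, Expr.ne])⟩
    refine ⟨by simp [Expr.eval, h6], ?_⟩
    have hsucc : (∀ v : Fin I.n, v < i + 1 →
        s.block I.n (s.var 5) v = s.block I.n (s.var 8) v) ↔
        (∀ v : Fin I.n, v < i → s.block I.n (s.var 5) v = s.block I.n (s.var 8) v) ∧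
          s.block I.n (s.var 5) ⟨i, hi⟩ = s.block I.n (s.var 8) ⟨i, hi⟩ := by
      constructor
      · exact fun h => ⟨fun v hv => h v (by omega), h _ (by simp)⟩
      · rintro ⟨h1, h2⟩ v hv
        rcases Nat.lt_succ_iff_lt_or_eq.1 hv with hv | hv
        · exact h1 v hv
        · obtain rfl : v = ⟨i, hi⟩ := Fin.ext hv
          exact h2
    rw [hsucc, ← hiff]
    simp [State.block, Expr.eval, Expr.eval_ne, h6, e5, e8, a1, a2]
  · rintro s' hF ⟨h6, -⟩
    have hin' : HasInput I s' := (hF.arr 0 rfl).trans hin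
    simp [Expr.eval, h6, hin'.n_eq]
  · simp only [Expr.cost]
    omega

theorem eval_stride (hin : HasInput I s) : stride.eval s = I.n + 1 := by
  simp [stride, Expr.eval, hin.n_eq]

theorem search_spec {len M : ℕ} (hX : I.n < X) (hin : HasInput I s)
    (hlen : s.var 8 = s.var 9 + len * (I.n + 1)) (hM : len ≤ M) (hM1 : 1 ≤ M) :
    RunsTo search s (100 * (M * X)) fun s' =>
      s'.var 11 ≠ 0 ↔ s.block I.n (s.var 8) ∈ s.blocks I.n (s.var 9) len := by
  refine (RunsTo.assign_seq (RunsTo.assign_seq ((RunsTo.loop (B := 60 * X + (6 + 7))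
    (fun i s' => s'.var 5 = s.var 9 + i * (I.n + 1) ∧ (s'.var 11 ≠ 0 ↔
      ∃ j < i, s.block I.n (s.var 9 + j * (I.n + 1)) = s.block I.n (s.var 8)))
    len ?_ ?_ ?_).imp fun s' _ h => h.2.trans State.mem_blocks.symm))).mono ?_
  · exact ⟨by simp [Expr.eval], by simp [Expr.eval]⟩
  · rintro i hi s' hF ⟨h5, hiff⟩
    have hin' : HasInput I s' := (hF.arr 0 rfl).trans hin
    have e8 : s'.var 8 = s.var 8 := hF.var 8 rfl
    have hblock : ∀ b, s'.block I.n b = s.block I.n b := by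
      intro b
      have a1 : s'.arr 1 = s.arr 1 := hF.arr 1 rfl
      have a2 : s'.arr 2 = s.arr 2 := hF.arr 2 rfl
      funext v
      simp only [State.block, a1, a2]
    have hlt : i * (I.n + 1) < len * (I.n + 1) := Nat.mul_lt_mul_of_pos_right hi (by omega)
    refine ⟨by simp [Expr.eval, h5, e8, hlen, hlt], ?_⟩
    refine ((compare_spec hX hin').seq fun s₁ hF₁ h12 => (RunsTo.assign_seq
      (RunsTo.assign ?_))).mono (by simp [Expr.cost, stride])
    have e5 : s₁.var 5 = s'.var 5 := hF₁.var 5 rfl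
    have e11 : s₁.var 11 = s'.var 11 := hF₁.var 11 rfl
    have hin₁ : HasInput I s₁ := hin'.frame hF₁ rfl
    rw [hblock, hblock, h5, e8] at h12
    refine ⟨by simp [Expr.eval, stride, hin₁.n_eq, e5, h5, Nat.succ_mul, add_assoc], ?_⟩
    have hsucc : (∃ j < i + 1, s.block I.n (s.var 9 + j * (I.n + 1)) = s.block I.n (s.var 8)) ↔
        (∃ j < i, s.block I.n (s.var 9 + j * (I.n + 1)) = s.block I.n (s.var 8)) ∨
          s.block I.n (s.var 9 + i * (I.n + 1)) = s.block I.n (s.var 8) := by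
      simp only [Nat.lt_succ_iff_lt_or_eq, or_and_right, exists_or, exists_eq_left]
    rw [hsucc, ← hiff, ← h12]
    simp [Expr.eval, e11]
    omega
  · rintro s' hF ⟨h5, -⟩
    have e8 : s'.var 8 = s.var 8 := hF.var 8 rfl
    simp [Expr.eval, h5, e8, hlen]
  · have := loop_bound (k := 4) hM hM1 (by omega : 1 ≤ X) (by omega : 60 * X + (6 + 7) ≤ 73 * X)
    have h1 : 1 ≤ M * X := Nat.mul_pos hM1 (by omega)
    simp only [Expr.cost, Nat.reduceAdd] at this ⊢
    omega

/-- Inserting a block adds one element to the stored set. The hypothesis `hAM` bounds the number of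
stored blocks, and thereby the time for the search. -/
theorem insert_spec {M : ℕ} {A : Set (Fin I.n → ℕ × ℕ)} (hX : I.n < X)
    (hin : HasInput I s) (hd : s.var 1 = d) (hc : s.var 3 = c)
    (hq : s.var 4 + I.n ≤ s.var 9) (hA : Stores s I.n (s.var 9) (s.var 8) A)
    (hAM : ∀ L : List (Fin I.n → ℕ × ℕ), L.Nodup → (∀ x ∈ L, x ∈ A) → L.length ≤ M)
    (hM1 : 1 ≤ M) :
    RunsTo (insert ℓ) s (250 * (M * X)) fun s' => SameBelow s s' (s.var 9) ∧
      Stores s' I.n (s.var 9) (s'.var 8) (A ∪ {I.advance ℓ d c (s.block I.n (s.var 4))}) := by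
  obtain ⟨len, hlen, hnodup, hmem⟩ := hA
  have hM : len ≤ M := by
    simpa [State.blocks] using hAM _ hnodup fun x => (hmem x).1
  have h1 : X ≤ M * X := Nat.le_mul_of_pos_left X hM1
  -- The new block is written just behind the stored ones; it is kept by moving their end.
  refine RunsTo.mono (B₁ := 100 * X + (100 * (M * X) + (1 + 1 + 7))) ?_ (by omega)
  refine (extend_spec hX hin hd hc (by have := hlen.ge; omega)).seq
    fun s₁ hF₁ ⟨hsame, hblock⟩ => ?_
  have e81 : s₁.var 8 = s.var 8 := hF₁.var 8 rfl
  have e91 : s₁.var 9 = s.var 9 := hF₁.var 9 rfl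
  refine (search_spec (len := len) hX (hin.frame hF₁ rfl) (by rw [e81, e91, hlen]) hM hM1).seq
    fun s₂ hF₂ h11 => RunsTo.ite ?_ ?_
  all_goals
    have e8 : s₂.var 8 = s.var 8 := (hF₂.var 8 rfl).trans e81
    have hsame₂ : SameBelow s s₂ (s.var 8) := hsame.trans fun i _ =>
      ⟨congrFun (hF₂.arr 1 rfl) i, congrFun (hF₂.arr 2 rfl) i⟩
    rw [e81, e91, hblock, hsame.blocks_eq hlen.ge, hmem] at h11
    intro h
  · refine (RunsTo.nop ⟨hsame₂.mono (by omega), ?_⟩).mono (by omega)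
    rw [e8, Set.union_eq_left.2 (Set.singleton_subset_iff.2 (h11.1 h))]
    exact hsame₂.stores le_rfl ⟨len, hlen, hnodup, hmem⟩
  · have hin₂ : HasInput I s₂ := (hin.frame hF₁ rfl).frame hF₂ rfl
    have hnot := fun hA => h11.2 hA h
    refine (RunsTo.assign (e := .add (.var 8) stride) ?_).mono le_rfl
    refine ⟨fun i hi => hsame₂ i (by omega), len + 1, ?_, ?_⟩
    · simp [Expr.eval, stride, hin₂.n_eq, e8, hlen, Nat.succ_mul, add_assoc]
    · change (s₂.blocks I.n (s.var 9) (len + 1)).Nodup ∧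
        ∀ x, x ∈ s₂.blocks I.n (s.var 9) (len + 1) ↔ _
      have hb₂ : s₂.block I.n (s.var 8) = I.advance ℓ d c (s.block I.n (s.var 4)) := by
        rw [← hblock]
        have a1 : s₂.arr 1 = s₁.arr 1 := hF₂.arr 1 rfl
        have a2 : s₂.arr 2 = s₁.arr 2 := hF₂.arr 2 rfl
        funext v
        simp only [State.block, a1, a2]
      rw [State.blocks_succ, ← hlen, hb₂, hsame₂.blocks_eq hlen.ge]
      refine ⟨hnodup.append (List.nodup_singleton _) ?_, fun x => ?_⟩
      · rw [List.disjoint_singleton, hmem]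
        exact hnot
      · simp [hmem, or_comm]

/-- The growing set `A` must consist of states that are reachable for `k + 1` parties, since this
bounds the number of stored blocks. -/
theorem grow_spec {A : Set (Fin I.n → ℕ × ℕ)} (hX : I.n < X) (hM1 : 1 ≤ M)
    (hM : ∀ k (L : List (Fin I.n → ℕ × ℕ)), L.Nodup → (∀ x ∈ L, I.Reachable ℓ d k x) →
      L.length ≤ M)
    (hin : HasInput I s) (hd : s.var 1 = d) (hc : s.var 3 = c) (hck : I.Eligible d k c)
    (hold : Stores s I.n (s.var 10) (s.var 9) {y | I.Reachable ℓ d k y})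
    (hA : Stores s I.n (s.var 9) (s.var 8) A) (hAk : ∀ x ∈ A, I.Reachable ℓ d (k + 1) x) :
    RunsTo (grow ℓ) s (300 * (M * (M * X))) fun s' => SameBelow s s' (s.var 9) ∧
      Stores s' I.n (s.var 9) (s'.var 8) (A ∪ I.advance ℓ d c '' {y | I.Reachable ℓ d k y}) := by
  obtain ⟨len, hlen, hnodup, hmem⟩ := hold
  have hlenM : len ≤ M := by simpa [State.blocks] using hM k _ hnodup fun x => (hmem x).1
  have hreach : ∀ j < len, I.Reachable ℓ d k (s.block I.n (s.var 10 + j * (I.n + 1))) :=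
    fun j hj => (hmem _).1 (State.mem_blocks.2 ⟨j, hj, rfl⟩)
  refine (RunsTo.assign_seq ((RunsTo.loop (B := 250 * (M * X) + 7)
    (fun i s' => s'.var 4 = s.var 10 + i * (I.n + 1) ∧ SameBelow s s' (s.var 9) ∧
      Stores s' I.n (s.var 9) (s'.var 8) (A ∪ {x | ∃ j < i, x = I.advance ℓ d c
        (s.block I.n (s.var 10 + j * (I.n + 1)))})) len ?_ ?_ ?_).imp
    fun s' _ h => ?_)).mono ?_
  · refine ⟨by simp [Expr.eval], SameBelow.refl _ _, ?_⟩
    change Stores s I.n (s.var 9) (s.var 8) _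
    simpa using hA
  · rintro i hi s' hF ⟨h4, hsame, hst⟩
    have hin' : HasInput I s' := (hF.arr 0 rfl).trans hin
    have e1 : s'.var 1 = d := (hF.var 1 rfl).trans hd
    have e3 : s'.var 3 = c := (hF.var 3 rfl).trans hc
    have e9 : s'.var 9 = s.var 9 := hF.var 9 rfl
    have hlt : (i + 1) * (I.n + 1) ≤ len * (I.n + 1) := Nat.mul_le_mul_right _ hi
    rw [Nat.succ_mul] at hlt
    have hblock : s'.block I.n (s'.var 4) = s.block I.n (s.var 10 + i * (I.n + 1)) := by
      rw [h4]
      exact hsame.block_eq (by omega)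
    refine ⟨by simp [Expr.eval, h4, e9, hlen]; omega, ?_⟩
    refine ((insert_spec (M := M) hX hin' e1 e3 (by rw [h4, e9]; omega)
      (by rw [e9]; exact hst) (fun L hL hLA => hM (k + 1) L hL fun x hx => ?_) hM1).seq
      fun s₁ hF₁ h₁ => RunsTo.assign ?_).mono (by simp [Expr.cost, stride])
    · rcases hLA x hx with h | ⟨j, hj, rfl⟩
      · exact hAk x h
      · exact ⟨c, _, hck, hreach j (hj.trans hi), rfl⟩
    · have e4 : s₁.var 4 = s'.var 4 := hF₁.var 4 rfl
      have hin₁ : HasInput I s₁ := hin'.frame hF₁ rfl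
      rw [e9, hblock] at h₁
      refine ⟨?_, hsame.trans h₁.1, ?_⟩
      · simp [Expr.eval, eval_stride hin₁, e4, h4, Nat.succ_mul, add_assoc]
      · change Stores s₁ I.n (s.var 9) (s₁.var 8) _
        convert h₁.2 using 1
        ext x
        simp only [Nat.lt_succ_iff_lt_or_eq, or_and_right, exists_or, exists_eq_left,
          Set.mem_union, Set.mem_ofPred_eq, Set.mem_singleton_iff, or_assoc]
  · rintro s' hF ⟨h4, -⟩
    have e9 : s'.var 9 = s.var 9 := hF.var 9 rfl
    simp [Expr.eval, h4, e9, hlen]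
  · refine ⟨h.2.1, ?_⟩
    convert h.2.2 using 2
    ext x
    constructor
    · rintro ⟨y, hy, rfl⟩
      obtain ⟨j, hj, rfl⟩ := State.mem_blocks.1 ((hmem y).2 hy)
      exact ⟨j, hj, rfl⟩
    · rintro ⟨j, hj, rfl⟩
      exact ⟨_, hreach j hj, rfl⟩
  · have h1 : 1 ≤ M * X := Nat.mul_pos hM1 (by omega)
    have h2 : 1 ≤ M * (M * X) := Nat.mul_pos hM1 h1
    have := loop_bound (k := 4) hlenM hM1 h1
      (by omega : 250 * (M * X) + 7 ≤ 257 * (M * X))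
    simp only [Expr.cost, Nat.reduceAdd] at this ⊢
    omega

theorem eval_ineligible (hin : HasInput I s) (hd : s.var 1 = d) (hk : s.var 2 = k)
    (hc : s.var 3 = c) : ineligible.eval s = 0 ↔ I.Eligible d k c := by
  simp only [ineligible, partyOf, Expr.eval, Expr.eval_ne, hd, hk, hc, hin.p_eq, hin.party_eq,
    NPInstance.Eligible, Fin.val_inj]
  split_ifs <;> simp_all

/-- One step of the dynamic program: from the states for `k` parties to those for `k + 1`. -/
theorem nextLayer_spec (hX : I.n < X) (hmX : I.m < X) (hM1 : 1 ≤ M)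
    (hM : ∀ k (L : List (Fin I.n → ℕ × ℕ)), L.Nodup → (∀ x ∈ L, I.Reachable ℓ d k x) →
      L.length ≤ M)
    (hin : HasInput I s) (hd : s.var 1 = d) (hk : s.var 2 = k)
    (hold : Stores s I.n (s.var 10) (s.var 9) {y | I.Reachable ℓ d k y}) :
    RunsTo (nextLayer ℓ) s (450 * (X * (M * (M * X)))) fun s' =>
      Stores s' I.n (s.var 9) (s'.var 8) {y | I.Reachable ℓ d (k + 1) y} := by
  have h1 : 1 ≤ M * X := Nat.mul_pos hM1 (by omega)
  have h2 : 1 ≤ M * (M * X) := Nat.mul_pos hM1 h1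
  refine (RunsTo.assign_seq (RunsTo.assign_seq ((RunsTo.loop
    (B := (100 + 300 * (M * (M * X))) + 4)
    (fun i s' => s'.var 3 = i ∧ SameBelow s s' (s.var 9) ∧
      Stores s' I.n (s.var 9) (s'.var 8) {x | ∃ c : Fin I.m, c < i ∧ I.Eligible d k c ∧
        ∃ y, I.Reachable ℓ d k y ∧ x = I.advance ℓ d c y}) I.m ?_ ?_ ?_).imp
    fun s' _ h => ?_))).mono ?_
  · refine ⟨rfl, SameBelow.refl _ _, ?_⟩
    simpa [Expr.eval] using Stores.empty _ I.n (s.var 9)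
  · rintro i hi s' hF ⟨h3, hsame, hst⟩
    have hin' : HasInput I s' := (hF.arr 0 rfl).trans hin
    have e1 : s'.var 1 = d := (hF.var 1 rfl).trans hd
    have e2 : s'.var 2 = k := (hF.var 2 rfl).trans hk
    have e9 : s'.var 9 = s.var 9 := hF.var 9 rfl
    have e10 : s'.var 10 = s.var 10 := hF.var 10 rfl
    have helig := eval_ineligible (c := ⟨i, hi⟩) hin' e1 e2 h3
    have hold' : Stores s' I.n (s'.var 10) (s'.var 9) {y | I.Reachable ℓ d k y} := by
      rw [e9, e10]
      exact hsame.stores le_rfl hold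
    refine ⟨by simp [Expr.eval, h3, hin'.m_eq, hi], ?_⟩
    refine RunsTo.seq (R₁ := fun s₁ => s₁.var 3 = i ∧ SameBelow s s₁ (s.var 9) ∧
      Stores s₁ I.n (s.var 9) (s₁.var 8) {x | ∃ c : Fin I.m, c < i + 1 ∧ I.Eligible d k c ∧
        ∃ y, I.Reachable ℓ d k y ∧ x = I.advance ℓ d c y})
      ((RunsTo.ite (B := 300 * (M * (M * X))) (fun h => ?_) fun h => ?_).mono
        (by simp [Expr.cost, ineligible, Expr.ne, partyOf]))
      fun s₁ hF₁ h₁ => RunsTo.assign ⟨by simp [Expr.eval, h₁.1], h₁.2.1, h₁.2.2⟩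
    · refine (RunsTo.nop ⟨h3, hsame, ?_⟩).mono (by omega)
      convert hst using 1
      ext x
      refine exists_congr fun c => ?_
      rw [Nat.lt_succ_iff_lt_or_eq]
      constructor
      · rintro ⟨hc | hc, h'⟩
        · exact ⟨hc, h'⟩
        · obtain rfl : c = ⟨i, hi⟩ := Fin.ext hc
          exact absurd (helig.2 h'.1) h
      · rintro ⟨hc, h'⟩
        exact ⟨Or.inl hc, h'⟩
    · refine (grow_spec (c := ⟨i, hi⟩) hX hM1 hM hin' e1 h3 (helig.1 h) hold'
        (by rw [e9]; exact hst) ?_).imp fun s₁ hF₁ h₁ => ?_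
      · rintro x ⟨c, -, hc, y, hy, rfl⟩
        exact ⟨c, y, hc, hy, rfl⟩
      · rw [e9] at h₁
        refine ⟨(hF₁.var 3 rfl).trans h3, hsame.trans h₁.1, ?_⟩
        convert h₁.2 using 1
        ext x
        simp only [Set.mem_union, Set.mem_ofPred_eq, Set.mem_image, Nat.lt_succ_iff_lt_or_eq,
          or_and_right, exists_or]
        refine or_congr Iff.rfl ⟨?_, ?_⟩
        · rintro ⟨c, hc, -, y, hy, rfl⟩
          obtain rfl : c = ⟨i, hi⟩ := Fin.ext hc
          exact ⟨y, hy, rfl⟩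
        · rintro ⟨y, hy, rfl⟩
          exact ⟨⟨i, hi⟩, rfl, helig.1 h, y, hy, rfl⟩
  · rintro s' hF ⟨h3, -⟩
    have hin' : HasInput I s' := (hF.arr 0 rfl).trans hin
    simp [Expr.eval, h3, hin'.m_eq]
  · convert h.2.2 using 1
    ext x
    constructor
    · rintro ⟨c, y, hc, hy, rfl⟩
      exact ⟨c, c.2, hc, y, hy, rfl⟩
    · rintro ⟨c, -, hc, y, hy, rfl⟩
      exact ⟨c, y, hc, hy, rfl⟩
  · have h3 : 1 ≤ X * (M * (M * X)) := Nat.mul_pos (by omega) h2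
    have := loop_bound (k := 5) hmX.le (by omega) h2
      (by omega : (100 + 300 * (M * (M * X))) + 4 ≤ 404 * (M * (M * X)))
    simp only [Expr.cost, Nat.reduceAdd] at this ⊢
    omega

theorem zeroBlock_spec (hX : I.n < X) (hin : HasInput I s) :
    RunsTo zeroBlock s (30 * X) fun s' => s'.block I.n 0 = fun _ => (0, 0) := by
  refine (RunsTo.assign_seq ((RunsTo.loop (B := 20)
    (fun i s' => s'.var 6 = i ∧ ∀ j < i, s'.arr 1 j = 0 ∧ s'.arr 2 j = 0) I.n ?_ ?_ ?_).imp
    fun s' _ h => ?_)).mono ?_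
  · exact ⟨rfl, fun j hj => absurd hj (by omega)⟩
  · rintro i hi s' hF ⟨h6, h⟩
    have hin' : HasInput I s' := (hF.arr 0 rfl).trans hin
    refine ⟨by simp [Expr.eval, h6, hin'.n_eq, hi], (RunsTo.write_seq (RunsTo.write_seq
      (RunsTo.assign ?_))).mono (by simp [Expr.cost])⟩
    refine ⟨by simp [Expr.eval, h6], fun j hj => ?_⟩
    by_cases hji : j = i
    · simp [Expr.eval, h6, hji]
    · simpa [Expr.eval, h6, hji] using h j (by omega)
  · rintro s' hF ⟨h6, -⟩
    have hin' : HasInput I s' := (hF.arr 0 rfl).trans hin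
    simp [Expr.eval, h6, hin'.n_eq]
  · funext v
    simp [State.block, h.2 v v.2]
  · simp only [Expr.cost]
    omega

theorem allLayers_spec (hX : I.n < X) (hmX : I.m < X) (htX : I.t < X) (hM1 : 1 ≤ M)
    (hM : ∀ k (L : List (Fin I.n → ℕ × ℕ)), L.Nodup → (∀ x ∈ L, I.Reachable ℓ d k x) →
      L.length ≤ M)
    (hin : HasInput I s) (hd : s.var 1 = d) :
    RunsTo (allLayers ℓ) s (530 * (X * (X * (M * (M * X))))) fun s' =>
      Stores s' I.n (s'.var 10) (s'.var 9) {y | I.Reachable ℓ d I.t y} := by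
  have h1 : X ≤ M * X := Nat.le_mul_of_pos_left X hM1
  have h2 : M * X ≤ M * (M * X) := Nat.le_mul_of_pos_left _ hM1
  have h3 : M * (M * X) ≤ X * (M * (M * X)) := Nat.le_mul_of_pos_left _ (by omega)
  have h4 : X * (M * (M * X)) ≤ X * (X * (M * (M * X))) := Nat.le_mul_of_pos_left _ (by omega)
  refine ((zeroBlock_spec hX hin).seq (B₂ := 500 * (X * (X * (M * (M * X)))))
    fun s₀ hF₀ hzero => ?_).mono (by omega)
  have hin₀ : HasInput I s₀ := hin.frame hF₀ rfl
  refine (RunsTo.assign_seq (RunsTo.assign_seq (RunsTo.assign_seq ((RunsTo.loop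
    (B := 450 * (X * (M * (M * X))) + (2 + (2 + 4)))
    (fun i s' => s'.var 2 = i ∧
      Stores s' I.n (s'.var 10) (s'.var 9) {y | I.Reachable ℓ d i y}) I.t ?_ ?_ ?_).imp
    fun s' _ h => h.2)))).mono ?_
  · refine ⟨rfl, 1, by simp [Expr.eval, stride, hin₀.n_eq], by simp [State.blocks], fun x => ?_⟩
    have hb : ∀ (s : State) b, s.blocks I.n b 1 = [s.block I.n b] := by simp [State.blocks]
    rw [hb]
    change x ∈ [s₀.block I.n 0] ↔ x = fun _ => (0, 0)
    rw [hzero, List.mem_singleton]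
  · rintro i hi s' hF ⟨h2', hst⟩
    have hin' : HasInput I s' := (hF.arr 0 rfl).trans hin₀
    have e1 : s'.var 1 = d := (hF.var 1 rfl).trans ((hF₀.var 1 rfl).trans hd)
    refine ⟨by simp [Expr.eval, h2', hin'.t_eq, hi], ?_⟩
    refine ((nextLayer_spec hX hmX hM1 hM hin' e1 h2' hst).seq fun s₁ hF₁ h₁ =>
      RunsTo.assign_seq (RunsTo.assign_seq (RunsTo.assign ?_))).mono (by simp [Expr.cost])
    have e9 : s₁.var 9 = s'.var 9 := hF₁.var 9 rfl
    have e2 : s₁.var 2 = s'.var 2 := hF₁.var 2 rfl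
    rw [← e9] at h₁
    refine ⟨by simp [Expr.eval, e2, h2'], ?_⟩
    exact h₁
  · rintro s' hF ⟨h2', -⟩
    have hin' : HasInput I s' := (hF.arr 0 rfl).trans hin₀
    simp [Expr.eval, h2', hin'.t_eq]
  · have := loop_bound (k := 5) htX.le (by omega) (by omega)
      (by omega : 450 * (X * (M * (M * X))) + (2 + (2 + 4)) ≤ 458 * (X * (M * (M * X))))
    simp only [Expr.cost, stride, Nat.reduceAdd] at this ⊢
    omega

theorem addScores_spec (hX : I.n < X) (hin : HasInput I s) :
    RunsTo addScores s (50 * X) fun s' =>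
      s'.var 13 = ∑ v, s.arr 3 (s.block I.n (s.var 4) v).1 ∧
      s'.var 14 = ∑ v, s.arr 3 (s.block I.n (s.var 4) v).2 := by
  refine (RunsTo.assign_seq (RunsTo.assign_seq (RunsTo.assign_seq ((RunsTo.loop (B := 30)
    (fun i s' => s'.var 6 = i ∧
      s'.var 13 = ∑ j ∈ Finset.range i, s.arr 3 (s.arr 1 (s.var 4 + j)) ∧
      s'.var 14 = ∑ j ∈ Finset.range i, s.arr 3 (s.arr 2 (s.var 4 + j))) I.n ?_ ?_ ?_).imp
    fun s' _ h => ?_)))).mono ?_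
  · exact ⟨rfl, rfl, rfl⟩
  · rintro i hi s' hF ⟨h6, h13, h14⟩
    have hin' : HasInput I s' := (hF.arr 0 rfl).trans hin
    have e4 : s'.var 4 = s.var 4 := hF.var 4 rfl
    have a1 : s'.arr 1 = s.arr 1 := hF.arr 1 rfl
    have a2 : s'.arr 2 = s.arr 2 := hF.arr 2 rfl
    have a3 : s'.arr 3 = s.arr 3 := hF.arr 3 rfl
    refine ⟨by simp [Expr.eval, h6, hin'.n_eq, hi], (RunsTo.assign_seq (RunsTo.assign_seq
      (RunsTo.assign ?_))).mono (by simp [Expr.cost])⟩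
    refine ⟨by simp [Expr.eval, h6], ?_, ?_⟩
    · simp [Expr.eval, h13, h6, e4, a1, a3, Finset.sum_range_succ]
    · simp [Expr.eval, h14, h6, e4, a2, a3, Finset.sum_range_succ]
  · rintro s' hF ⟨h6, -⟩
    have hin' : HasInput I s' := (hF.arr 0 rfl).trans hin
    simp [Expr.eval, h6, hin'.n_eq]
  · exact ⟨h.2.1.trans (Finset.sum_range _), h.2.2.trans (Finset.sum_range _)⟩
  · simp only [Expr.cost]
    omega

theorem eval_lt_ne_zero {e₁ e₂ : Expr} :
    (Expr.lt e₁ e₂).eval s ≠ 0 ↔ e₁.eval s < e₂.eval s := by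
  simp only [Expr.eval]
  split_ifs with h <;> simp [h]

theorem judge_spec {A : Set (Fin I.n → ℕ × ℕ)} (hX : I.n < X) (hM1 : 1 ≤ M)
    (hAM : ∀ L : List (Fin I.n → ℕ × ℕ), L.Nodup → (∀ x ∈ L, x ∈ A) → L.length ≤ M)
    (hin : HasInput I s) (hA : Stores s I.n (s.var 10) (s.var 9) A) :
    RunsTo judge s (100 * (M * X)) fun s' => s'.var 0 ≠ 0 ↔ s.var 0 ≠ 0 ∧
      ∀ x ∈ A, ∑ v, s.arr 3 (x v).2 ≤ ∑ v, s.arr 3 (x v).1 := by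
  obtain ⟨len, hlen, hnodup, hmem⟩ := hA
  have hlenM : len ≤ M := by simpa [State.blocks] using hAM _ hnodup fun x => (hmem x).1
  refine (RunsTo.assign_seq ((RunsTo.loop (B := 50 * X + ((3 + 1 + 2) + 7))
    (fun i s' => s'.var 4 = s.var 10 + i * (I.n + 1) ∧ (s'.var 0 ≠ 0 ↔ s.var 0 ≠ 0 ∧
      ∀ j < i, ∑ v, s.arr 3 (s.block I.n (s.var 10 + j * (I.n + 1)) v).2 ≤
        ∑ v, s.arr 3 (s.block I.n (s.var 10 + j * (I.n + 1)) v).1)) len ?_ ?_ ?_).imp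
    fun s' _ h => ?_)).mono ?_
  · exact ⟨by simp [Expr.eval], by simp⟩
  · rintro i hi s' hF ⟨h4, hiff⟩
    have hin' : HasInput I s' := (hF.arr 0 rfl).trans hin
    have e9 : s'.var 9 = s.var 9 := hF.var 9 rfl
    have a1 : s'.arr 1 = s.arr 1 := hF.arr 1 rfl
    have a2 : s'.arr 2 = s.arr 2 := hF.arr 2 rfl
    have a3 : s'.arr 3 = s.arr 3 := hF.arr 3 rfl
    have hblock : s'.block I.n (s'.var 4) = s.block I.n (s.var 10 + i * (I.n + 1)) := by
      funext v
      simp only [State.block, a1, a2, h4]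
    have hlt : i * (I.n + 1) < len * (I.n + 1) := Nat.mul_lt_mul_of_pos_right hi (by omega)
    refine ⟨by simp [Expr.eval, h4, e9, hlen, hlt], ?_⟩
    refine (addScores_spec hX hin').seq fun s₁ hF₁ h₁ => ?_
    rw [hblock, a3] at h₁
    have hin₁ : HasInput I s₁ := hin'.frame hF₁ rfl
    have e4 : s₁.var 4 = s'.var 4 := hF₁.var 4 rfl
    have e0 : s₁.var 0 = s'.var 0 := hF₁.var 0 rfl
    refine RunsTo.seq (B₁ := 3 + 1 + 2) (R₁ := fun s₂ => s₂.var 0 ≠ 0 ↔ s₁.var 0 ≠ 0 ∧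
        s₁.var 14 ≤ s₁.var 13)
      (RunsTo.ite (B := 2) (fun h => RunsTo.assign ?_) fun h => RunsTo.mono (RunsTo.nop ?_)
        (by omega)) fun s₂ hF₂ h₂ => (RunsTo.assign ?_).mono (by simp [Expr.cost, stride])
    · have h' := eval_lt_ne_zero.1 h
      simp only [Expr.eval] at h' ⊢
      simp [h']
    · have h' := mt eval_lt_ne_zero.2 (not_not.2 h)
      simp only [Expr.eval, not_lt] at h'
      simp [h']
    · have e4' : s₂.var 4 = s₁.var 4 := hF₂.var 4 rfl
      have hin₂ : HasInput I s₂ := hin₁.frame hF₂ rfl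
      refine ⟨by simp [Expr.eval, eval_stride hin₂, e4, e4', h4, Nat.succ_mul, add_assoc], ?_⟩
      change s₂.var 0 ≠ 0 ↔ _
      rw [h₂, e0, hiff, h₁.1, h₁.2, and_assoc]
      refine and_congr_right fun _ => ?_
      simp only [Nat.lt_succ_iff_lt_or_eq, or_imp, forall_and, forall_eq]
  · rintro s' hF ⟨h4, -⟩
    have e9 : s'.var 9 = s.var 9 := hF.var 9 rfl
    simp [Expr.eval, h4, e9, hlen]
  · rw [h.2]
    refine and_congr_right fun _ => ?_
    simp only [← hmem, State.mem_blocks, forall_exists_index, and_imp]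
    constructor
    · rintro h x j hj rfl
      exact h j hj
    · exact fun h j hj => h _ j hj rfl
  · have h1 : 1 ≤ M * X := Nat.mul_pos hM1 (by omega)
    have := loop_bound (k := 4) hlenM hM1 (by omega : 1 ≤ X)
      (by omega : 50 * X + ((3 + 1 + 2) + 7) ≤ 63 * X)
    simp only [Expr.cost, Nat.reduceAdd] at this ⊢
    omega

theorem writeTable_spec (g : ℕ → ℕ) (k : ℕ) (s : State) :
    RunsTo (writeTable g k) s (3 * k + 1) fun s' =>
      s'.arr 0 = s.arr 0 ∧ ∀ i < k, s'.arr 3 i = g i := by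
  induction k with
  | zero => exact RunsTo.nop ⟨rfl, fun i hi => absurd hi (by omega)⟩
  | succ k ih =>
    refine (ih.seq fun s' _ h => RunsTo.write ?_).mono (by simp [Expr.cost]; omega)
    refine ⟨by simpa using h.1, fun i hi => ?_⟩
    by_cases hik : i = k
    · simp [Expr.eval, hik]
    · simpa [Expr.eval, hik] using h.2 i (by omega)

theorem selectTable_spec (tab : ℕ → ℕ → ℕ) (T : ℕ) (hin : HasInput I s) :
    RunsTo (selectTable tab ℓ T) s (5 * T + 3 * (ℓ + 1) + 1) fun s' =>
      HasInput I s' ∧ ∀ i < ℓ + 1, s'.arr 3 i = tab (min I.t T) i := by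
  induction T with
  | zero =>
    refine ((writeTable_spec (tab 0) (ℓ + 1) s).imp fun s' _ h => ⟨h.1.trans hin, ?_⟩).mono
      (by omega)
    simpa using h.2
  | succ T ih =>
    refine (RunsTo.ite (B := 5 * T + 3 * (ℓ + 1) + 1) (fun h => ?_) fun h => ?_).mono
      (by simp [Expr.cost]; omega)
    · refine ((writeTable_spec (tab (T + 1)) (ℓ + 1) s).imp
        fun s' _ h' => ⟨h'.1.trans hin, ?_⟩).mono (by omega)
      simp [Expr.eval, hin.t_eq] at h
      rw [min_eq_right (by omega)]
      exact h'.2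
    · refine ih.imp fun s' _ h' => ⟨h'.1, ?_⟩
      simp [Expr.eval, hin.t_eq] at h
      rw [min_eq_left (by omega)]
      rw [min_eq_left (by omega)] at h'
      exact h'.2

/-- Correctness and running time of the whole program, with points given by `tab`. The factors are
`X` for each of the loops over rivals, parties, candidates and voters, and `M` for each of the two
nested loops over stored blocks. -/
theorem decideNP_spec (tab : ℕ → ℕ → ℕ) (hX : I.n < X) (hmX : I.m < X) (htX : I.t < X)
    (hM1 : 1 ≤ M)
    (hM : ∀ d k (L : List (Fin I.n → ℕ × ℕ)), L.Nodup → (∀ x ∈ L, I.Reachable ℓ d k x) →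
      L.length ≤ M) (hin : HasInput I s) :
    RunsTo (decideNP tab ℓ) s
      (8 * (ℓ + 1) + 1 + 700 * (X * (X * (X * (M * (M * X)))))) fun s' =>
      s'.var 0 ≠ 0 ↔ ∀ d x, I.Reachable ℓ d I.t x →
        ∑ v, tab (min I.t (ℓ + 1)) (x v).2 ≤ ∑ v, tab (min I.t (ℓ + 1)) (x v).1 := by
  have h1 : X ≤ M * X := Nat.le_mul_of_pos_left X hM1
  have h2 : M * X ≤ M * (M * X) := Nat.le_mul_of_pos_left _ hM1
  have h3 : M * (M * X) ≤ X * (M * (M * X)) := Nat.le_mul_of_pos_left _ (by omega)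
  have h4 : X * (M * (M * X)) ≤ X * (X * (M * (M * X))) := Nat.le_mul_of_pos_left _ (by omega)
  have h5 : X * (X * (M * (M * X))) ≤ X * (X * (X * (M * (M * X)))) :=
    Nat.le_mul_of_pos_left _ (by omega)
  refine ((selectTable_spec tab (ℓ + 1) hin).seq
    (B₂ := 700 * (X * (X * (X * (M * (M * X)))))) fun s₀ _ ⟨hin₀, htab⟩ => ?_).mono (by omega)
  refine (RunsTo.assign_seq (RunsTo.assign_seq ((RunsTo.loop
    (B := 530 * (X * (X * (M * (M * X)))) + (100 * (M * X) + 4))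
    (fun i s' => s'.var 1 = i ∧ (s'.var 0 ≠ 0 ↔ ∀ d : Fin I.m, d < i → ∀ x,
      I.Reachable ℓ d I.t x →
        ∑ v, tab (min I.t (ℓ + 1)) (x v).2 ≤ ∑ v, tab (min I.t (ℓ + 1)) (x v).1))
    I.m ?_ ?_ ?_).imp fun s' _ h => ?_))).mono ?_
  · exact ⟨rfl, by simp [Expr.eval]⟩
  · rintro i hi s' hF ⟨h1', hiff⟩
    have hin' : HasInput I s' := (hF.arr 0 rfl).trans hin₀
    have a3 : s'.arr 3 = s₀.arr 3 := hF.arr 3 rfl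
    refine ⟨by simp [Expr.eval, h1', hin'.m_eq, hi], ?_⟩
    refine (allLayers_spec (d := ⟨i, hi⟩) hX hmX htX hM1 (hM _) hin' h1').seq
      fun s₁ hF₁ h₁ => (judge_spec (A := {y | I.Reachable ℓ ⟨i, hi⟩ I.t y}) hX hM1 (hM ⟨i, hi⟩ I.t) (hin'.frame hF₁ rfl) h₁).seq
      fun s₂ hF₂ h₂ => RunsTo.assign ?_
    have e1 : s₂.var 1 = s'.var 1 := (hF₂.var 1 rfl).trans (hF₁.var 1 rfl)
    have e0 : s₁.var 0 = s'.var 0 := hF₁.var 0 rfl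
    have a3' : s₁.arr 3 = s₀.arr 3 := (hF₁.arr 3 rfl).trans a3
    refine ⟨by simp [Expr.eval, e1, h1'], ?_⟩
    change s₂.var 0 ≠ 0 ↔ _
    rw [h₂, e0, hiff, a3']
    have hsum : (∀ x ∈ {y | I.Reachable ℓ ⟨i, hi⟩ I.t y},
        ∑ v, s₀.arr 3 (x v).2 ≤ ∑ v, s₀.arr 3 (x v).1) ↔ ∀ x, I.Reachable ℓ ⟨i, hi⟩ I.t x →
        ∑ v, tab (min I.t (ℓ + 1)) (x v).2 ≤ ∑ v, tab (min I.t (ℓ + 1)) (x v).1 := by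
      refine forall₂_congr fun x (hx : I.Reachable ℓ _ _ x) => ?_
      rw [Finset.sum_congr rfl fun v _ => htab _ (Nat.lt_succ_of_le (hx.le v).1),
        Finset.sum_congr rfl fun v _ => htab _ (Nat.lt_succ_of_le (hx.le v).2)]
    rw [hsum]
    constructor
    · rintro ⟨h, h'⟩ d hd
      rcases Nat.lt_succ_iff_lt_or_eq.1 hd with hd | hd
      · exact h d hd
      · obtain rfl : d = ⟨i, hi⟩ := Fin.ext hd
        exact h'
    · exact fun h => ⟨fun d hd => h d (by omega), h _ (by simp)⟩
  · rintro s' hF ⟨h1', -⟩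
    have hin' : HasInput I s' := (hF.arr 0 rfl).trans hin₀
    simp [Expr.eval, h1', hin'.m_eq]
  · exact h.2.trans ⟨fun h d => h d d.2, fun h d _ => h d⟩
  · have := loop_bound (k := 5) hmX.le (by omega) (by omega)
      (by omega : 530 * (X * (X * (M * (M * X)))) + (100 * (M * X) + 4) ≤
        634 * (X * (X * (M * (M * X)))))
    simp only [Expr.cost, Nat.reduceAdd] at this ⊢
    omega

end Parts

end RAM

/-! ### Fixed-parameter tractability of Necessary President -/

/-- For every Veto-like scoring rule, Necessary President is fixed-parameter tractable with
respect to the number of voter types. -/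
theorem theorem7 (ℓ : ℕ) (hℓ : 1 ≤ ℓ) (a : ℚ) (b : Fin ℓ → ℚ) (hb : Antitone b)
    (hab : b ⟨0, hℓ⟩ < a) (w : ScoringVectors) (hw : IsVetoLike w ℓ a b) :
    (necessaryPresident w).IsFPT := by
  obtain ⟨tab, D, K, hD, htab⟩ := NPInstance.exists_natTable w ℓ
  refine ⟨RAM.decideNP tab ℓ,
    fun τ => 8 * (ℓ + 1) + 1 + 700 * (((ℓ + 1) ^ 2) ^ τ * ((ℓ + 1) ^ 2) ^ τ), 4, ?_, ?_⟩
  · have hpow : Primrec fun τ : ℕ => ((ℓ + 1) ^ 2) ^ τ :=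
      (Primrec₂.unpaired'.1 Nat.Primrec.pow).comp (Primrec.const _) Primrec.id
    exact (Primrec.nat_add.comp (Primrec.const _) (Primrec.nat_mul.comp (Primrec.const _)
      (Primrec.nat_mul.comp hpow hpow))).to_comp
  · intro I
    obtain ⟨hmX, hnX, htX⟩ := I.lt_inputLength
    obtain ⟨T, s, hE, hT, hs⟩ := RAM.decideNP_spec (ℓ := ℓ) (s := RAM.initState I.encode) tab
      hnX hmX htX (Nat.one_le_pow _ _ (by positivity))
      (fun d k L => NPInstance.length_le_of_reachable) (by funext i; rfl)
    refine ⟨T, s, hE, hT.trans ?_, hs.trans (Iff.trans ?_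
      (NPInstance.isNecessaryPresident_iff hw).symm)⟩
    -- The time for writing the table is constant and is absorbed by the factor depending on `τ`.
    · have hX4 : 1 ≤ RAM.inputLength I.encode ^ 4 := Nat.one_le_pow _ _ (by omega)
      have := Nat.le_mul_of_pos_right (8 * (ℓ + 1) + 1) hX4
      simp only [necessaryPresident]
      calc _ ≤ (8 * (ℓ + 1) + 1) * RAM.inputLength I.encode ^ 4 + _ := add_le_add_left this _
        _ = _ := by ring
    · refine forall₂_congr fun d x => forall_congr' fun hx => ?_
      -- Both totals are sums over the same `I.n` voters, so that the shifts by `K` cancel.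
      have hcast : ∀ f : Fin I.n → ℕ, (∀ v, f v ≤ ℓ) →
          ((∑ v, tab (min I.t (ℓ + 1)) (f v) : ℕ) : ℚ) = D * (∑ v, w (min I.t (ℓ + 1))
            (min I.t (ℓ + 1) - 1 - f v)) + I.n * K := by
        intro f hf
        rw [Nat.cast_sum, Finset.sum_congr rfl fun v _ => htab _ (min_le_right _ _) _ (hf v),
          Finset.sum_add_distrib, Finset.mul_sum]
        simp
      rw [← Nat.cast_le (α := ℚ), hcast _ fun v => (hx.le v).2, hcast _ fun v => (hx.le v).1,
        add_le_add_iff_right, mul_le_mul_iff_right₀ hD]
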